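/- Let $(X,\omega_X)$ be a connected Kähler manifold of complex dimension $n$, let $1\le k\le n$, and let $(Y,\omega_Y)$ be a toric Kähler manifold of complex dimension $n-k$: a complex manifold with a holomorphic $(\mathbb C^*)^{n-k}$-action having an open dense free orbit $Y_0$, and with a Kähler form for which the action of the compact torus $T^{n-k}$ is Hamiltonian. Put $E=Y\setminus Y_0$. For a function $h$ the Hamiltonian vector field $V_h$ is defined by $\iota_{V_h}\omega=dh$, and $\{g,h\}=\omega(V_g,V_h)$. Suppose $X$ carries a pseudotoric structure over $Y$, that is: * a Hamiltonian $T^k$-action on $(X,\omega_X)$, with (invariant) moment map $\mu:X\to\mathrm{Lie}(T^k)^*$, whose generating vector fields form a space of dimension $k$ (no nonzero element of $\mathrm{Lie}(T^k)$ generates the zero vector field); * a meromorphic map $F:X\dashrightarrow Y$ whose base (indeterminacy) locus $B$ is a $T^k$-invariant analytic subset which is empty or of complex dimension $k-1$, such that the holomorphic map $F:X\setminus B\to Y$ is $T^k$-invariant; * for every smooth function $h:Y\to\mathbb R$ there is a function $\varphi:X\setminus B\to\mathbb R$ such that, at all points of $X\setminus B$ where $F$ is a submersion, $V_{F^*h}=\varphi\cdot\nabla_F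 V_h$, where $\nabla_FV_h$ is the horizontal lift of $V_h$ (the lift that is $\omega_X$-orthogonal to $\ker dF$). Let $\Omega_X$ be a meromorphic $n$-form on $X$ without zeros and with simple poles exactly along a reduced (hence anticanonical) divisor $D\subset X$. Fix a basis of $\mathrm{Lie}(T^k)$, with generating vector fields $V_1,\dots,V_k$ on $X$ and components $\mu_1,\dots,\mu_k$ of $\mu$, so that $\iota_{V_i}\omega_X=d\mu_i$. Let $f_1,\dots,f_{n-k}$ be meromorphic functions on $Y$ which are holomorphic on $Y_0$. Assume: 1. $D$ is $T^k$-invariant; 2. $B\subset D$ and $F(X\setminus D)\subset Y\setminus E=Y_0$; 3. the functions $F^*f_j$ have no zeros on $X\setminus D$, and there $\iota_{V_1}\cdots\iota_{V_k}\Omega_X=d\log F^*f_1\wedge\cdots\wedge d\log F^*f_{n-k}$; 4. the functions $\nu_j=|f_j|$ Poisson commute pairwise with respect to $\omega_Y$ on $Y_0$ (at the points where the two functions concerned do not vanish). Then $$\rho=(\mu_1,\dots,\mu_k,F^*\nu_1,\dots,F^*\nu_{n-k}):X\setminus D\to\mathbb R^n$$ is a special Lagrangian fibration on $X\setminus D$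 (possibly with singular fibres): $\rho$ is smooth, its components Poisson commute, $\rho$ is a submersion on an open dense subset of $X\setminus D$, and there is $\theta\in\mathbb R$ such that the set of regular points of every fibre of $\rho$ is a Lagrangian submanifold $L$ with $\operatorname{Im}(e^{\sqrt{-1}\,\theta}\Omega_X)|_L=0$. -/

import Mathlib

open scoped Manifold ContDiff Topology

noncomputable section

/-!
Throughout, a complex manifold is a type `X` charted on a finite-dimensional complex normed space
`E` with complex-analytic transition maps (`IsManifold 𝓘(ℂ, E) ω X`).  In Mathlib the tangent space
of `X` at `x` is (by definition) the model space `E`, the identification being given by the chart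
`chartAt E x`; this holds for `X` as a complex manifold (model `𝓘(ℂ, E)`) and as the underlying real
manifold (model `𝓘(ℝ, E)`).  The complex structure of `T_x X` is multiplication by `Complex.I`.
Hence a `p`-form on `X` is a function `X → E [⋀^Fin p]→L[𝕜] 𝕜`.
-/

section Forms

variable {E : Type*} [NormedAddCommGroup E] {X : Type*} [TopologicalSpace X] [ChartedSpace E X]

/-- The coordinate expression of a differential form `η` in the chart around `x₀`: its pullback
under the inverse of the chart. -/
def formInChart (𝕜 : Type*) [NontriviallyNormedField 𝕜] [NormedSpace 𝕜 E] {p : ℕ}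
    (η : X → E [⋀^Fin p]→L[𝕜] 𝕜) (x₀ : X) (u : E) : E [⋀^Fin p]→L[𝕜] 𝕜 :=
  (η ((chartAt E x₀).symm u)).compContinuousLinearMap
    (mfderiv 𝓘(𝕜, E) 𝓘(𝕜, E) (chartAt E x₀).symm u : E →L[𝕜] E)

variable [NormedSpace ℂ E]

/-- `κ` is a Kähler form: a smooth closed real 2-form of type (1,1) which is positive. -/
structure IsKahlerForm (κ : X → E [⋀^Fin 2]→L[ℝ] ℝ) : Prop where
  smooth : ∀ x₀ : X, ContDiffOn ℝ ∞ (formInChart ℝ κ x₀) (chartAt E x₀).target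
  closed : ∀ x₀ : X, ∀ u ∈ (chartAt E x₀).target, extDeriv (formInChart ℝ κ x₀) u = 0
  type_one_one : ∀ (x : X) (v w : E), κ x ![Complex.I • v, Complex.I • w] = κ x ![v, w]
  pos : ∀ (x : X) (v : E), v ≠ 0 → 0 < κ x ![v, Complex.I • v]

/-- `η` is a holomorphic `p`-form on the open set `U`. -/
def IsHolomorphicFormOn {p : ℕ} (η : X → E [⋀^Fin p]→L[ℂ] ℂ) (U : Set X) : Prop :=
  ∀ x₀ : X, ContDiffOn ℂ ω (formInChart ℂ η x₀)
    ((chartAt E x₀).target ∩ (chartAt E x₀).symm ⁻¹' U)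

/-- `v` is the value at `x` of the Hamiltonian vector field `V_h` of `h`: `ι_{V_h} κ = dh`. -/
def IsHamiltonianVector (κ : X → E [⋀^Fin 2]→L[ℝ] ℝ) (h : X → ℝ) (x : X) (v : E) : Prop :=
  ∀ w : E, κ x ![v, w] = (mfderiv 𝓘(ℝ, E) 𝓘(ℝ, ℝ) h x : E →L[ℝ] ℝ) w

/-- The Poisson bracket `{g, h} = κ(V_g, V_h)` vanishes at `x`. -/
def PoissonCommuteAt (κ : X → E [⋀^Fin 2]→L[ℝ] ℝ) (g h : X → ℝ) (x : X) : Prop :=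
  ∀ v w : E, IsHamiltonianVector κ g x v → IsHamiltonianVector κ h x w → κ x ![v, w] = 0

end Forms

section TorusActions

/-- The exponential map `ℝᵏ = Lie(Tᵏ) → Tᵏ` of the compact torus. -/
def torusExp {k : ℕ} (s : Fin k → ℝ) : Fin k → Circle := fun i => Circle.exp (s i)

/-- The exponential map `ℂᵐ → (ℂˣ)ᵐ` of the complex torus. -/
def complexTorusExp {m : ℕ} (z : Fin m → ℂ) : Fin m → ℂˣ :=
  fun i => Units.mk0 (Complex.exp (z i)) (Complex.exp_ne_zero (z i))

/-- The inclusion `Tᵐ → (ℂˣ)ᵐ` of the compact torus. -/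
def torusInclusion {m : ℕ} (t : Fin m → Circle) : Fin m → ℂˣ := fun i => Circle.toUnits (t i)

variable {E : Type*} [NormedAddCommGroup E] [NormedSpace ℂ E]
  {X : Type*} [TopologicalSpace X] [ChartedSpace E X]

/-- The vector field on `X` generated by `v ∈ Lie(Tᵏ)`: the velocity of `s ↦ exp(sv) · x`. -/
def fundamentalVectorField {k : ℕ} (act : (Fin k → Circle) → X → X) (v : Fin k → ℝ) (x : X) : E :=
  (mfderiv 𝓘(ℝ, ℝ) 𝓘(ℝ, E) (fun s : ℝ => act (torusExp (s • v)) x) 0 : ℝ →L[ℝ] E) 1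

/-- `act` is a Hamiltonian action of `Tᵏ` on `(X, κ)` with moment map `μ : X → Lie(Tᵏ)*`.
Smoothness of the action is expressed through the covering `ℝᵏ → Tᵏ`. -/
structure IsHamiltonianTorusAction {k : ℕ} (κ : X → E [⋀^Fin 2]→L[ℝ] ℝ)
    (act : (Fin k → Circle) → X → X) (μ : X → (Fin k → ℝ) →L[ℝ] ℝ) : Prop where
  one_act : ∀ x, act 1 x = x
  mul_act : ∀ s t x, act (s * t) x = act s (act t x)
  smooth_act : ContMDiff (𝓘(ℝ, Fin k → ℝ).prod 𝓘(ℝ, E)) 𝓘(ℝ, E) ∞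
    (fun p : (Fin k → ℝ) × X => act (torusExp p.1) p.2)
  symplectic : ∀ (t : Fin k → Circle) (x : X) (v w : E),
    κ (act t x) ![(mfderiv 𝓘(ℝ, E) 𝓘(ℝ, E) (act t) x : E →L[ℝ] E) v,
      (mfderiv 𝓘(ℝ, E) 𝓘(ℝ, E) (act t) x : E →L[ℝ] E) w] = κ x ![v, w]
  smooth_moment : ContMDiff 𝓘(ℝ, E) 𝓘(ℝ, (Fin k → ℝ) →L[ℝ] ℝ) ∞ μ
  moment_invariant : ∀ t x, μ (act t x) = μ x
  moment_eq : ∀ (v : Fin k → ℝ) (x : X),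
    IsHamiltonianVector κ (fun y => μ y v) x (fundamentalVectorField act v x)

/-- A toric Kähler manifold of complex dimension `m`: a holomorphic action of `(ℂˣ)ᵐ` with an open
dense free orbit, and a Kähler form for which the action of the compact torus `Tᵐ ⊂ (ℂˣ)ᵐ` is
Hamiltonian. -/
structure ToricKahlerStructure (m : ℕ) (E : Type*) [NormedAddCommGroup E] [NormedSpace ℂ E]
    (Y : Type*) [TopologicalSpace Y] [ChartedSpace E Y] where
  form : Y → E [⋀^Fin 2]→L[ℝ] ℝ
  kahler : IsKahlerForm form
  act : (Fin m → ℂˣ) → Y → Y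
  one_act : ∀ y, act 1 y = y
  mul_act : ∀ s t y, act (s * t) y = act s (act t y)
  holomorphic_act : ContMDiff (𝓘(ℂ, Fin m → ℂ).prod 𝓘(ℂ, E)) 𝓘(ℂ, E) ω
    (fun p : (Fin m → ℂ) × Y => act (complexTorusExp p.1) p.2)
  basePoint : Y
  isOpen_orbit : IsOpen (Set.range fun t => act t basePoint)
  dense_orbit : Dense (Set.range fun t => act t basePoint)
  free_orbit : Function.Injective fun t => act t basePoint
  moment : Y → (Fin m → ℝ) →L[ℝ] ℝ
  hamiltonian : IsHamiltonianTorusAction form (fun t => act (torusInclusion t)) moment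

/-- The open dense orbit `Y₀ ≅ (ℂˣ)ᵐ`. -/
def ToricKahlerStructure.openOrbit {m : ℕ} {Y : Type*} [TopologicalSpace Y] [ChartedSpace E Y]
    (T : ToricKahlerStructure m E Y) : Set Y :=
  Set.range fun t => T.act t T.basePoint

/-- The toric anticanonical divisor: the complement of the open orbit. -/
def ToricKahlerStructure.toricDivisor {m : ℕ} {Y : Type*} [TopologicalSpace Y] [ChartedSpace E Y]
    (T : ToricKahlerStructure m E Y) : Set Y :=
  T.openOrbitᶜ

end TorusActions

section Analytic

/-- `A` is an analytic subset: locally the common zero set of finitely many holomorphic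
functions. -/
def IsAnalyticSubset {E : Type*} [NormedAddCommGroup E] [NormedSpace ℂ E] {H : Type*}
    [TopologicalSpace H] (I : ModelWithCorners ℂ E H) {M : Type*} [TopologicalSpace M]
    [ChartedSpace H M] (A : Set M) : Prop :=
  ∀ x : M, ∃ U : Set M, IsOpen U ∧ x ∈ U ∧ ∃ (N : ℕ) (g : M → Fin N → ℂ),
    ContMDiffOn I 𝓘(ℂ, Fin N → ℂ) ω g U ∧ A ∩ U = {y ∈ U | g y = 0}

variable {E : Type*} [NormedAddCommGroup E] [NormedSpace ℂ E]
  {X : Type*} [TopologicalSpace X] [ChartedSpace E X]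
  {E' : Type*} [NormedAddCommGroup E'] [NormedSpace ℂ E']
  {Y : Type*} [TopologicalSpace Y] [ChartedSpace E' Y]

/-- Near `x`, the set `A` is a complex submanifold of complex dimension `d`: the zero set of a
holomorphic submersion to `ℂᶜ`, where `d + c` is the dimension of the ambient manifold. -/
def IsComplexSubmanifoldNear (A : Set X) (d : ℕ) (x : X) : Prop :=
  ∃ c : ℕ, d + c = Module.finrank ℂ E ∧ ∃ U : Set X, IsOpen U ∧ x ∈ U ∧
    ∃ g : X → Fin c → ℂ, ContMDiffOn 𝓘(ℂ, E) 𝓘(ℂ, Fin c → ℂ) ω g U ∧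
      (∀ y ∈ U, Function.Surjective
        (mfderiv 𝓘(ℂ, E) 𝓘(ℂ, Fin c → ℂ) g y : E →L[ℂ] (Fin c → ℂ))) ∧
      A ∩ U = {y ∈ U | g y = 0}

/-- The analytic subset `A` has complex dimension `d`: the largest dimension of `A` at its regular
points is `d`. -/
def HasComplexDimension (A : Set X) (d : ℕ) : Prop :=
  (∃ x ∈ A, IsComplexSubmanifoldNear (E := E) A d x) ∧
    ∀ x ∈ A, ∀ e : ℕ, IsComplexSubmanifoldNear (E := E) A e x → e ≤ d

/-- `F : X ⇢ Y` is a meromorphic map (in the sense of Remmert) with base locus, i.e. indeterminacy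
locus, `B`.  The values of the function `F` on `B` are irrelevant. -/
structure IsMeromorphicMap (F : X → Y) (B : Set X) : Prop where
  analytic_base : IsAnalyticSubset 𝓘(ℂ, E) B
  dense_compl : Dense Bᶜ
  holomorphic : ContMDiffOn 𝓘(ℂ, E) 𝓘(ℂ, E') ω F Bᶜ
  analytic_graph : IsAnalyticSubset (𝓘(ℂ, E).prod 𝓘(ℂ, E'))
    (closure {p : X × Y | p.1 ∉ B ∧ p.2 = F p.1})
  proper_graph :
    IsProperMap fun p : closure {p : X × Y | p.1 ∉ B ∧ p.2 = F p.1} => p.1.1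
  not_extendable : ∀ x ∈ B, ∀ U : Set X, IsOpen U → x ∈ U →
    ¬ ∃ G : X → Y, ContMDiffOn 𝓘(ℂ, E) 𝓘(ℂ, E') ω G U ∧ Set.EqOn G F (U \ B)

/-- `f` is a meromorphic function: locally a quotient of holomorphic functions whose denominator
does not vanish identically on any open set.  Values at points where no such quotient has a
nonvanishing denominator are irrelevant. -/
def IsMeromorphicFunction (f : Y → ℂ) : Prop :=
  ∀ y : Y, ∃ U : Set Y, IsOpen U ∧ y ∈ U ∧ ∃ g h : Y → ℂ,
    ContMDiffOn 𝓘(ℂ, E') 𝓘(ℂ, ℂ) ω g U ∧ ContMDiffOn 𝓘(ℂ, E') 𝓘(ℂ, ℂ) ω h U ∧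
    U ⊆ closure {z ∈ U | h z ≠ 0} ∧ ∀ z ∈ U, h z ≠ 0 → f z = g z / h z

/-- `Ω` is a meromorphic `n`-form on `X` (`n = dim X`) without zeros and with simple poles exactly
along the reduced divisor `D`: near every point, `D = {s = 0}` for a holomorphic `s` whose
differential is nonzero on a dense subset of `D`, and `s Ω` extends to a nowhere vanishing
holomorphic `n`-form `η`.  In particular `Ω⁻¹` is a holomorphic section of `-K_X` with divisor `D`,
so that `D` is an anticanonical divisor.  The values of `Ω` on `D` are irrelevant. -/
def IsVolumeFormWithSimplePoles {n : ℕ} (Ω : X → E [⋀^Fin n]→L[ℂ] ℂ) (D : Set X) : Prop :=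
  ∀ x : X, ∃ U : Set X, IsOpen U ∧ x ∈ U ∧ ∃ (s : X → ℂ) (η : X → E [⋀^Fin n]→L[ℂ] ℂ),
    ContMDiffOn 𝓘(ℂ, E) 𝓘(ℂ, ℂ) ω s U ∧
    D ∩ U = {y ∈ U | s y = 0} ∧
    D ∩ U ⊆ closure {y ∈ D ∩ U | (mfderiv 𝓘(ℂ, E) 𝓘(ℂ, ℂ) s y : E →L[ℂ] ℂ) ≠ 0} ∧
    IsHolomorphicFormOn η U ∧ (∀ y ∈ U, η y ≠ 0) ∧ ∀ y ∈ U \ D, η y = s y • Ω y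

/-- The logarithmic differential `d log g` at `x`. -/
def dlog (g : X → ℂ) (x : X) : E →L[ℂ] ℂ :=
  (g x)⁻¹ • (mfderiv 𝓘(ℂ, E) 𝓘(ℂ, ℂ) g x : E →L[ℂ] ℂ)

/-- The value `(α₁ ∧ ⋯ ∧ α_m)(w₁, …, w_m) = det (α_i(w_j))`. -/
def wedgeApply {m : ℕ} (α : Fin m → E →L[ℂ] ℂ) (w : Fin m → E) : ℂ :=
  Matrix.det (Matrix.of fun i j => α i (w j))

end Analytic

section Pseudotoric

variable {E : Type*} [NormedAddCommGroup E] [NormedSpace ℂ E]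
  {X : Type*} [TopologicalSpace X] [ChartedSpace E X]
  {E' : Type*} [NormedAddCommGroup E'] [NormedSpace ℂ E']
  {Y : Type*} [TopologicalSpace Y] [ChartedSpace E' Y]

/-- `w ∈ T_x X` is the horizontal lift of `u ∈ T_{F(x)} Y` for the symplectic connection of `F`: it
projects to `u` and is `κ`-orthogonal to `ker dF`. -/
def IsHorizontalLift (κ : X → E [⋀^Fin 2]→L[ℝ] ℝ) (F : X → Y) (x : X) (u : E') (w : E) : Prop :=
  (mfderiv 𝓘(ℝ, E) 𝓘(ℝ, E') F x : E →L[ℝ] E') w = u ∧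
    ∀ v : E, (mfderiv 𝓘(ℝ, E) 𝓘(ℝ, E') F x : E →L[ℝ] E') v = 0 → κ x ![w, v] = 0

/-- A pseudotoric structure on the Kähler manifold `(X, κ)`, with values in the toric Kähler
manifold `(Y, T)` of dimension `m` (the rank). -/
structure PseudotoricStructure (k : ℕ) {m : ℕ} (κ : X → E [⋀^Fin 2]→L[ℝ] ℝ)
    (T : ToricKahlerStructure m E' Y) where
  act : (Fin k → Circle) → X → X
  moment : X → (Fin k → ℝ) →L[ℝ] ℝ
  hamiltonian : IsHamiltonianTorusAction κ act moment
  /-- The generating vector fields of a basis of `Lie(Tᵏ)` are linearly independent vector fields,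
  i.e. only finitely many elements of `Tᵏ` act trivially. -/
  locally_effective : ∀ v : Fin k → ℝ,
    (∀ x : X, (fundamentalVectorField act v x : E) = 0) → v = 0
  map : X → Y
  base : Set X
  meromorphic : IsMeromorphicMap (E := E) (E' := E') map base
  base_invariant : ∀ t, ∀ x ∈ base, act t x ∈ base
  /-- The base locus has dimension `k - 1`, or is empty (as it is if `Y` is a point). -/
  base_dim : base = ∅ ∨ HasComplexDimension (E := E) base (k - 1)
  map_invariant : ∀ t, ∀ x ∉ base, map (act t x) = map x
  /-- `V_{F^* h}` is a multiple of the horizontal lift of `V_h`, wherever `F` is a submersion. -/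
  parallel : ∀ h : Y → ℝ, ContMDiff 𝓘(ℝ, E') 𝓘(ℝ, ℝ) ∞ h → ∃ f : X → ℝ, ∀ x ∉ base,
    Function.Surjective (mfderiv 𝓘(ℝ, E) 𝓘(ℝ, E') map x : E →L[ℝ] E') →
    ∀ (VFh : E) (Vh : E') (w : E), IsHamiltonianVector κ (h ∘ map) x VFh →
      IsHamiltonianVector T.form h (map x) Vh → IsHorizontalLift κ map x Vh w →
      VFh = f x • w

end Pseudotoric

section SpecialLagrangian

variable {E : Type*} [NormedAddCommGroup E] [NormedSpace ℂ E]
  {X : Type*} [TopologicalSpace X] [ChartedSpace E X]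

/-- `L` is a special Lagrangian submanifold of phase `θ` of the `n`-dimensional complex manifold
`X`: near each of its points, `L` is the zero set of a smooth submersion `g` to `ℝⁿ`, and on the
tangent spaces `T_y L = ker dg_y` (of real dimension `n`) both `κ` and `Im (e^{iθ} Ω)` vanish. -/
def IsSpecialLagrangian {n : ℕ} (κ : X → E [⋀^Fin 2]→L[ℝ] ℝ) (Ω : X → E [⋀^Fin n]→L[ℂ] ℂ)
    (θ : ℝ) (L : Set X) : Prop :=
  ∀ x ∈ L, ∃ U : Set X, IsOpen U ∧ x ∈ U ∧ ∃ g : X → Fin n → ℝ,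
    ContMDiffOn 𝓘(ℝ, E) 𝓘(ℝ, Fin n → ℝ) ∞ g U ∧
    (∀ y ∈ U, Function.Surjective
      (mfderiv 𝓘(ℝ, E) 𝓘(ℝ, Fin n → ℝ) g y : E →L[ℝ] (Fin n → ℝ))) ∧
    L ∩ U = {y ∈ U | g y = 0} ∧
    ∀ y ∈ L ∩ U,
      (∀ v w : E, (mfderiv 𝓘(ℝ, E) 𝓘(ℝ, Fin n → ℝ) g y : E →L[ℝ] (Fin n → ℝ)) v = 0 →
        (mfderiv 𝓘(ℝ, E) 𝓘(ℝ, Fin n → ℝ) g y : E →L[ℝ] (Fin n → ℝ)) w = 0 →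
        κ y ![v, w] = 0) ∧
      (∀ v : Fin n → E,
        (∀ i, (mfderiv 𝓘(ℝ, E) 𝓘(ℝ, Fin n → ℝ) g y : E →L[ℝ] (Fin n → ℝ)) (v i) = 0) →
        (Complex.exp (θ * Complex.I) * Ω y v).im = 0)

/-- The points of `U` at which `ρ` is a submersion. -/
def regularLocus {n : ℕ} (ρ : X → Fin n → ℝ) (U : Set X) : Set X :=
  {x ∈ U | Function.Surjective
    (mfderiv 𝓘(ℝ, E) 𝓘(ℝ, Fin n → ℝ) ρ x : E →L[ℝ] (Fin n → ℝ))}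

/-- `ρ` is a special Lagrangian fibration (singular fibres being allowed) on the open set `U`: a
smooth map with Poisson commuting components, which is a submersion on an open dense subset of `U`,
and such that for some `θ` every fibre is, at the regular points of `ρ`, a special Lagrangian
submanifold of phase `θ`.  (Fibres over regular values consist of regular points only.) -/
structure IsSpecialLagrangianFibrationOn {n : ℕ} (κ : X → E [⋀^Fin 2]→L[ℝ] ℝ)
    (Ω : X → E [⋀^Fin n]→L[ℂ] ℂ) (ρ : X → Fin n → ℝ) (U : Set X) : Prop where
  isOpen : IsOpen U
  smooth : ContMDiffOn 𝓘(ℝ, E) 𝓘(ℝ, Fin n → ℝ) ∞ ρ U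
  poisson : ∀ i j, ∀ x ∈ U, PoissonCommuteAt κ (fun y => ρ y i) (fun y => ρ y j) x
  isOpen_regular : IsOpen (regularLocus (E := E) ρ U)
  dense_regular : U ⊆ closure (regularLocus (E := E) ρ U)
  special : ∃ θ : ℝ, ∀ b : Fin n → ℝ,
    IsSpecialLagrangian κ Ω θ {x ∈ regularLocus (E := E) ρ U | ρ x = b}

end SpecialLagrangian

end

/-!
The generating fields of a locally effective torus action are linearly independent at a dense set of
points, and there they span an isotropic, hence totally real, subspace. So `ι_{V₁} ⋯ ι_{V_k} Ω` is
nonzero there, and by (iii) the forms `d log F^*f_j` are independent: `F` is a submersion, and so is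
`ρ`, because `κ(V_i, ·)` and the real parts of forms killing the `V_i` are independent.
Where `F` is a submersion, `V_{F^*ν_i}` is parallel to the horizontal lift of `V_{ν_i}`, so `F^*ν_i`
and `F^*ν_j` Poisson commute, and they do so everywhere by continuity. Finally the
Hamiltonian vectors of the components of `ρ` span the tangent space of the fibre at a regular point;
`Re (d log F^*f_j)` vanishes on it, so `Ω` takes there the value of a determinant with imaginary
entries, which lies in `√-1ᵐ ℝ`: the phase is `-mπ/2`.
-/

/-- The real differential of a map of manifolds, as a map between the model spaces, with which
Mathlib identifies the tangent spaces. -/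
noncomputable def realMFDeriv (E E' : Type*) [NormedAddCommGroup E] [NormedSpace ℝ E]
    [NormedAddCommGroup E'] [NormedSpace ℝ E'] {X Y : Type*} [TopologicalSpace X]
    [ChartedSpace E X] [TopologicalSpace Y] [ChartedSpace E' Y] (f : X → Y) (x : X) :
    E →L[ℝ] E' :=
  mfderiv 𝓘(ℝ, E) 𝓘(ℝ, E') f x

section RestrictScalars

theorem isManifold_real_of_complex (E : Type*) [NormedAddCommGroup E] [NormedSpace ℂ E]
    (X : Type*) [TopologicalSpace X] [ChartedSpace E X] [IsManifold 𝓘(ℂ, E) ω X] :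
    IsManifold 𝓘(ℝ, E) ∞ X := by
  refine isManifold_of_contDiffOn _ _ _ fun e e' he he' => ?_
  have h_compat := (contDiffGroupoid ω 𝓘(ℂ, E)).compatible he he'
  rw [contDiffGroupoid, mem_groupoid_of_pregroupoid] at h_compat
  exact (h_compat.1.restrict_scalars ℝ).of_le le_top

variable {E : Type*} [NormedAddCommGroup E] [NormedSpace ℂ E]
  {X : Type*} [TopologicalSpace X] [ChartedSpace E X]
  {E' : Type*} [NormedAddCommGroup E'] [NormedSpace ℂ E']
  {Y : Type*} [TopologicalSpace Y] [ChartedSpace E' Y] {f : X → Y}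

theorem contMDiffOn_real_of_complex {s : Set X} (hf : ContMDiffOn 𝓘(ℂ, E) 𝓘(ℂ, E') ω f s) :
    ContMDiffOn 𝓘(ℝ, E) 𝓘(ℝ, E') ∞ f s := fun x hx =>
  have hfx := contMDiffWithinAt_iff.1 (hf x hx)
  contMDiffWithinAt_iff.2 ⟨hfx.1, (hfx.2.restrict_scalars ℝ).of_le le_top⟩

theorem hasMFDerivAt_real_of_complex {x : X} {f' : E →L[ℂ] E'}
    (hf : HasMFDerivAt 𝓘(ℂ, E) 𝓘(ℂ, E') f x f') :
    HasMFDerivAt 𝓘(ℝ, E) 𝓘(ℝ, E') f x (f'.restrictScalars ℝ) :=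
  ⟨hf.1, HasFDerivWithinAt.restrictScalars ℝ hf.2⟩

theorem realMFDeriv_eq_restrictScalars {x : X} (hf : MDifferentiableAt 𝓘(ℂ, E) 𝓘(ℂ, E') f x) :
    realMFDeriv E E' f x =
      (mfderiv 𝓘(ℂ, E) 𝓘(ℂ, E') f x : E →L[ℂ] E').restrictScalars ℝ :=
  (hasMFDerivAt_real_of_complex hf.hasMFDerivAt).mfderiv

end RestrictScalars

section ChainRule

variable {F₁ F₂ F₃ M₁ M₂ M₃ : Type*}
  [NormedAddCommGroup F₁] [NormedSpace ℝ F₁] [NormedAddCommGroup F₂] [NormedSpace ℝ F₂]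
  [NormedAddCommGroup F₃] [NormedSpace ℝ F₃]
  [TopologicalSpace M₁] [ChartedSpace F₁ M₁] [TopologicalSpace M₂] [ChartedSpace F₂ M₂]
  [TopologicalSpace M₃] [ChartedSpace F₃ M₃]
  {g : M₂ → M₃} {f : M₁ → M₂} {x : M₁} {y : M₂} {f' : F₁ →L[ℝ] F₂}

theorem hasMFDerivAt_realMFDeriv (hf : MDifferentiableAt 𝓘(ℝ, F₁) 𝓘(ℝ, F₂) f x) :
    HasMFDerivAt 𝓘(ℝ, F₁) 𝓘(ℝ, F₂) f x (realMFDeriv F₁ F₂ f x) :=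
  hf.hasMFDerivAt

theorem hasMFDerivAt_comp_of_eq {g' : F₂ →L[ℝ] F₃}
    (hg : HasMFDerivAt 𝓘(ℝ, F₂) 𝓘(ℝ, F₃) g y g')
    (hf : HasMFDerivAt 𝓘(ℝ, F₁) 𝓘(ℝ, F₂) f x f') (hy : f x = y) :
    HasMFDerivAt 𝓘(ℝ, F₁) 𝓘(ℝ, F₃) (g ∘ f) x (g'.comp f') := by
  subst hy
  exact HasMFDerivAt.comp x hg hf

theorem realMFDeriv_comp (hg : MDifferentiableAt 𝓘(ℝ, F₂) 𝓘(ℝ, F₃) g (f x))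
    (hf : MDifferentiableAt 𝓘(ℝ, F₁) 𝓘(ℝ, F₂) f x) :
    realMFDeriv F₁ F₃ (g ∘ f) x = (realMFDeriv F₂ F₃ g (f x)).comp (realMFDeriv F₁ F₂ f x) :=
  mfderiv_comp x hg hf

theorem hasMFDerivAt_zero_comp_of_eq
    (hg : MDifferentiableAt 𝓘(ℝ, F₂) 𝓘(ℝ, F₃) g y)
    (hf : HasMFDerivAt 𝓘(ℝ, F₁) 𝓘(ℝ, F₂) f x (0 : F₁ →L[ℝ] F₂)) (hy : f x = y) :
    HasMFDerivAt 𝓘(ℝ, F₁) 𝓘(ℝ, F₃) (g ∘ f) x (0 : F₁ →L[ℝ] F₃) :=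
  have h_zero : (realMFDeriv F₂ F₃ g y).comp (0 : F₁ →L[ℝ] F₂) = 0 :=
    ContinuousLinearMap.comp_zero _
  h_zero ▸ hasMFDerivAt_comp_of_eq (hasMFDerivAt_realMFDeriv hg) hf hy

end ChainRule

section Chart

variable {E : Type*} [NormedAddCommGroup E] {X : Type*} [TopologicalSpace X] [ChartedSpace E X]

theorem mem_closure_chart_target_inter {x : X} {S : Set X} (hx : x ∈ closure S) :
    chartAt E x x ∈ closure ((chartAt E x).target ∩ (chartAt E x).symm ⁻¹' S) := by
  rw [mem_closure_iff]
  intro W hW hxW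
  obtain ⟨z, hz, hzS⟩ := mem_closure_iff.1 hx _ ((chartAt E x).isOpen_inter_preimage hW)
    ⟨mem_chart_source E x, hxW⟩
  exact ⟨chartAt E x z, hz.2, (chartAt E x).map_source hz.1,
    by simpa [(chartAt E x).left_inv hz.1] using hzS⟩

variable [NormedSpace ℝ E] {V : Type*} [NormedAddCommGroup V] [NormedSpace ℝ V]

theorem bijective_realMFDeriv_chart_symm [IsManifold 𝓘(ℝ, E) 1 X] (x₀ : X) {u : E}
    (hu : u ∈ (chartAt E x₀).target) :
    Function.Bijective (realMFDeriv E E (chartAt E x₀).symm u) :=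
  (mdifferentiable_chart (I := 𝓘(ℝ, E)) x₀).symm.mfderiv_bijective hu

theorem fderiv_comp_chart_symm [IsManifold 𝓘(ℝ, E) 1 X] {h : X → V} (x₀ : X) {u : E}
    (hu : u ∈ (chartAt E x₀).target)
    (hh : MDifferentiableAt 𝓘(ℝ, E) 𝓘(ℝ, V) h ((chartAt E x₀).symm u)) :
    fderiv ℝ (h ∘ (chartAt E x₀).symm) u =
      (realMFDeriv E V h ((chartAt E x₀).symm u)).comp
        (realMFDeriv E E (chartAt E x₀).symm u) := by
  rw [← mfderiv_eq_fderiv]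
  exact mfderiv_comp u hh (mdifferentiableAt_atlas_symm (chart_mem_atlas E x₀) hu)

theorem continuousOn_fderiv_comp_chart_symm [IsManifold 𝓘(ℝ, E) 1 X] {h : X → V} {U : Set X}
    (hU : IsOpen U) (hh : ContMDiffOn 𝓘(ℝ, E) 𝓘(ℝ, V) 1 h U) (x₀ : X) :
    ContinuousOn (fderiv ℝ (h ∘ (chartAt E x₀).symm))
      ((chartAt E x₀).target ∩ (chartAt E x₀).symm ⁻¹' U) := by
  have h_smooth : ContDiffOn ℝ 1 (h ∘ (chartAt E x₀).symm)
      ((chartAt E x₀).target ∩ (chartAt E x₀).symm ⁻¹' U) :=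
    contMDiffOn_iff_contDiffOn.1 <|
      hh.comp ((contMDiffOn_chart_symm (I := 𝓘(ℝ, E))).mono Set.inter_subset_left) fun _ hu => hu.2
  exact h_smooth.continuousOn_fderiv_of_isOpen ((chartAt E x₀).isOpen_inter_preimage_symm hU) le_rfl

variable [IsManifold 𝓘(ℝ, E) 1 X]

theorem eq_of_hasMFDerivAt_zero {f : V → X}
    (hf : ∀ v, HasMFDerivAt 𝓘(ℝ, V) 𝓘(ℝ, E) f v (0 : V →L[ℝ] E)) (v w : V) : f v = f w := by
  refine IsLocallyConstant.apply_eq_of_preconnectedSpace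
    ((IsLocallyConstant.iff_eventually_eq f).2 fun v => ?_) v w
  obtain ⟨δ, hδ, h_source⟩ := Metric.mem_nhds_iff.1
    ((hf v).continuousAt.preimage_mem_nhds (chart_source_mem_nhds E (f v)))
  have h_chart : ∀ u ∈ Metric.ball v δ,
      HasFDerivAt (chartAt E (f v) ∘ f) (0 : V →L[ℝ] E) u := fun u hu =>
    (hasMFDerivAt_zero_comp_of_eq (mdifferentiableAt_atlas (I := 𝓘(ℝ, E))
      (chart_mem_atlas E (f v)) (h_source hu)) (hf u) rfl).hasFDerivAt
  filter_upwards [Metric.ball_mem_nhds v hδ] with u hu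
  exact (chartAt E (f v)).injOn (h_source hu) (h_source (Metric.mem_ball_self hδ)) <|
    Metric.isOpen_ball.is_const_of_fderiv_eq_zero (convex_ball v δ).isPreconnected
      (fun u hu => (h_chart u hu).differentiableAt.differentiableWithinAt)
      (fun u hu => (h_chart u hu).fderiv) hu (Metric.mem_ball_self hδ)

end Chart

/-- A smooth action on the manifold `X` of the additive group of the normed space `V`; the actions
of the torus `Tᵏ` are those of `V = ℝᵏ` with the lattice `2πℤᵏ` acting trivially. -/
structure IsSmoothAction (E : Type*) [NormedAddCommGroup E] [NormedSpace ℝ E]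
    {V : Type*} [NormedAddCommGroup V] [NormedSpace ℝ V]
    {X : Type*} [TopologicalSpace X] [ChartedSpace E X] (a : V → X → X) : Prop where
  zero_act : ∀ x, a 0 x = x
  add_act : ∀ u v x, a (u + v) x = a u (a v x)
  contMDiff : ContMDiff (𝓘(ℝ, V).prod 𝓘(ℝ, E)) 𝓘(ℝ, E) ∞ fun p : V × X => a p.1 p.2

/-- The differential at `0` of the orbit map `u ↦ a u x`; it sends `v` to the value at `x` of the
vector field generated by `v`. -/
noncomputable def orbitDeriv (E : Type*) [NormedAddCommGroup E] [NormedSpace ℝ E]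
    {V : Type*} [NormedAddCommGroup V] [NormedSpace ℝ V]
    {X : Type*} [TopologicalSpace X] [ChartedSpace E X] (a : V → X → X) (x : X) : V →L[ℝ] E :=
  realMFDeriv V E (fun u => a u x) 0

namespace IsSmoothAction

variable {E : Type*} [NormedAddCommGroup E] [NormedSpace ℝ E]
  {V : Type*} [NormedAddCommGroup V] [NormedSpace ℝ V]
  {X : Type*} [TopologicalSpace X] [ChartedSpace E X] {a : V → X → X}

section Orbits

theorem contMDiff_orbit (ha : IsSmoothAction E a) (x : X) :
    ContMDiff 𝓘(ℝ, V) 𝓘(ℝ, E) ∞ fun u => a u x :=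
  ha.contMDiff.comp (contMDiff_id.prodMk contMDiff_const)

theorem contMDiff_act (ha : IsSmoothAction E a) (u : V) : ContMDiff 𝓘(ℝ, E) 𝓘(ℝ, E) ∞ (a u) :=
  ha.contMDiff.comp (contMDiff_const.prodMk contMDiff_id)

theorem hasMFDerivAt_orbit (ha : IsSmoothAction E a) (x : X) :
    HasMFDerivAt 𝓘(ℝ, V) 𝓘(ℝ, E) (fun u => a u x) 0 (orbitDeriv E a x : V →L[ℝ] E) :=
  ((ha.contMDiff_orbit x).mdifferentiable (by simp) 0).hasMFDerivAt

theorem hasMFDerivAt_curve (ha : IsSmoothAction E a) (x : X) (v : V) :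
    HasMFDerivAt 𝓘(ℝ, ℝ) 𝓘(ℝ, E) (fun s : ℝ => a (s • v) x) 0
      ((orbitDeriv E a x).comp (ContinuousLinearMap.toSpanSingleton ℝ v)) :=
  have h_line : HasMFDerivAt 𝓘(ℝ, ℝ) 𝓘(ℝ, V) (fun s : ℝ => s • v) 0
      (ContinuousLinearMap.toSpanSingleton ℝ v) :=
    (ContinuousLinearMap.toSpanSingleton ℝ v).hasFDerivAt.hasMFDerivAt
  hasMFDerivAt_comp_of_eq (ha.hasMFDerivAt_orbit x) h_line (zero_smul ℝ v)

theorem realMFDeriv_orbitDeriv_eq_zero (ha : IsSmoothAction E a) {W : Type*}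
    [NormedAddCommGroup W] [NormedSpace ℝ W] {φ : X → W} {x : X}
    (hφ : MDifferentiableAt 𝓘(ℝ, E) 𝓘(ℝ, W) φ x) (h_inv : ∀ u, φ (a u x) = φ x) (v : V) :
    realMFDeriv E W φ x (orbitDeriv E a x v) = 0 := by
  have h_comp := hasMFDerivAt_comp_of_eq (hasMFDerivAt_realMFDeriv hφ) (ha.hasMFDerivAt_orbit x)
    (ha.zero_act x)
  rw [show (φ ∘ fun u => a u x) = fun _ => φ x from funext h_inv] at h_comp
  exact DFunLike.congr_fun (hasMFDerivAt_unique h_comp (hasMFDerivAt_const (φ x) (0 : V))) v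

theorem hasMFDerivAt_curve_zero (ha : IsSmoothAction E a) {x : X} {v : V}
    (hv : orbitDeriv E a x v = 0) (s : ℝ) :
    HasMFDerivAt 𝓘(ℝ, ℝ) 𝓘(ℝ, E) (fun t : ℝ => a (t • v) x) s (0 : ℝ →L[ℝ] E) := by
  have h_zero : HasMFDerivAt 𝓘(ℝ, ℝ) 𝓘(ℝ, E) (fun t : ℝ => a (t • v) x) 0 (0 : ℝ →L[ℝ] E) := by
    have h_eq : (orbitDeriv E a x).comp (ContinuousLinearMap.toSpanSingleton ℝ v) = 0 := by
      ext
      simp [hv]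
    exact h_eq ▸ ha.hasMFDerivAt_curve x v
  have h_sub : HasMFDerivAt 𝓘(ℝ, ℝ) 𝓘(ℝ, ℝ) (fun t : ℝ => t - s) s
      (ContinuousLinearMap.id ℝ ℝ) := ((hasFDerivAt_id s).sub_const s).hasMFDerivAt
  have h_shift : HasMFDerivAt 𝓘(ℝ, ℝ) 𝓘(ℝ, E) (fun t : ℝ => a ((t - s) • v) x) s
      (0 : ℝ →L[ℝ] E) :=
    have h_eq : (0 : ℝ →L[ℝ] E).comp (ContinuousLinearMap.id ℝ ℝ) = 0 :=
      ContinuousLinearMap.zero_comp _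
    h_eq ▸ hasMFDerivAt_comp_of_eq h_zero h_sub (sub_self s)
  have h_act := hasMFDerivAt_zero_comp_of_eq (y := x)
    ((ha.contMDiff_act (s • v)).mdifferentiable (by simp) x) h_shift (by simp [ha.zero_act])
  have h_comp : (a (s • v) ∘ fun t : ℝ => a ((t - s) • v) x) = fun t => a (t • v) x := by
    funext t
    rw [Function.comp_apply, ← ha.add_act, ← add_smul, add_sub_cancel]
  rwa [h_comp] at h_act

theorem orbitDeriv_eq_zero_iff [IsManifold 𝓘(ℝ, E) 1 X] (ha : IsSmoothAction E a) {x : X}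
    {v : V} : orbitDeriv E a x v = 0 ↔ ∀ s : ℝ, a (s • v) x = x := by
  refine ⟨fun hv s => ?_, fun hs => ?_⟩
  · simpa [ha.zero_act] using eq_of_hasMFDerivAt_zero (ha.hasMFDerivAt_curve_zero hv) s 0
  · have h_curve := ha.hasMFDerivAt_curve x v
    rw [show (fun s : ℝ => a (s • v) x) = fun _ => x from funext hs] at h_curve
    have h_one : orbitDeriv E a x ((1 : ℝ) • v) = 0 := DFunLike.congr_fun
      (hasMFDerivAt_unique h_curve (hasMFDerivAt_const x (0 : ℝ))) (1 : ℝ)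
    rwa [one_smul] at h_one

end Orbits

end IsSmoothAction

section Lattice

theorem exists_nat_smul_near_span {V ι : Type*} [NormedAddCommGroup V] [NormedSpace ℝ V]
    [Finite ι] (b : Module.Basis ι ℝ V) (w : V) {ε : ℝ} (hε : 0 < ε) :
    ∃ N : ℕ, 1 ≤ N ∧ ∃ l ∈ Submodule.span ℤ (Set.range b), ‖(N : ℝ) • w - l‖ < ε := by
  have := Fintype.ofFinite ι
  have : FiniteDimensional ℝ V := b.finiteDimensional_of_finite
  have h_bounded : ∀ N : ℕ, ZSpan.fract b ((N : ℝ) • w) ∈ Metric.closedBall 0 (∑ i, ‖b i‖) :=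
    fun N => by simpa using ZSpan.norm_fract_le b _
  obtain ⟨_, -, φ, hφ, h_lim⟩ := (isCompact_closedBall _ _).tendsto_subseq h_bounded
  obtain ⟨N₀, hN₀⟩ := Metric.cauchySeq_iff.1 h_lim.cauchySeq ε hε
  have h_lt : φ N₀ < φ (N₀ + 1) := hφ N₀.lt_succ_self
  refine ⟨φ (N₀ + 1) - φ N₀, by omega, _, Submodule.sub_mem _
    (ZSpan.floor b ((φ (N₀ + 1) : ℝ) • w)).2 (ZSpan.floor b ((φ N₀ : ℝ) • w)).2, ?_⟩
  have h_close := hN₀ (N₀ + 1) (by omega) N₀ le_rfl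
  rw [Function.comp_apply, Function.comp_apply, dist_eq_norm, ZSpan.fract_apply,
    ZSpan.fract_apply] at h_close
  rwa [Nat.cast_sub h_lt.le, sub_smul, sub_sub_sub_comm]

end Lattice

section FiniteOrder

theorem eventually_eq_of_iterate_eventually_eq {E : Type*} [NormedAddCommGroup E]
    [NormedSpace ℝ E] {G : E → E} {u : E} (hG : HasStrictFDerivAt G (ContinuousLinearMap.id ℝ E) u)
    (hu : G u = u) {q : ℕ} (hq : q ≠ 0) (hGq : ∀ᶠ v in 𝓝 u, G^[q] v = v) :
    ∀ᶠ v in 𝓝 u, G v = v := by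
  -- the sum of the iterates is injective near `u`, and it is invariant under `G`
  have h_strict : HasStrictFDerivAt (fun v => ∑ j ∈ Finset.range q, G^[j] v)
      (∑ _j ∈ Finset.range q, ContinuousLinearMap.id ℝ E) u :=
    HasStrictFDerivAt.fun_sum fun j _ => by
      simpa [← ContinuousLinearMap.one_def] using hG.iterate hu j
  have h_tendsto : Filter.Tendsto (fun v => (G v, v)) (𝓝 u) (𝓝 (u, u)) := by
    simpa [hu] using (hG.continuousAt.prodMk continuousAt_id).tendsto
  have h_bound := (h_strict.isLittleO.comp_tendsto h_tendsto).def one_half_pos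
  filter_upwards [h_bound, hGq] with v hv hvq
  have h_invariant : ∑ j ∈ Finset.range q, G^[j] (G v) = ∑ j ∈ Finset.range q, G^[j] v := by
    rw [← sub_eq_zero, ← Finset.sum_sub_distrib]
    simp_rw [← Function.iterate_succ_apply]
    rw [Finset.sum_range_sub (fun j => G^[j] v), hvq, Function.iterate_zero_apply, sub_self]
  have h_le : (q : ℝ) * ‖G v - v‖ ≤ 1 / 2 * ‖G v - v‖ := by
    simpa [h_invariant, ← Nat.cast_smul_eq_nsmul ℝ, norm_smul, ← smul_sub, norm_sub_rev] using hv
  have hq_one : (1 : ℝ) ≤ q := by exact_mod_cast Nat.one_le_iff_ne_zero.2 hq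
  have h_norm : ‖G v - v‖ ≤ 0 := by nlinarith [norm_nonneg (G v - v)]
  exact sub_eq_zero.1 (norm_le_zero_iff.1 h_norm)

theorem hasStrictFDerivAt_id_of_eqOn {E : Type*} [NormedAddCommGroup E] [NormedSpace ℝ E]
    {G : E → E} {u : E} (hG : ContDiffAt ℝ 1 G u) {s : Set E} (hs : IsOpen s) (hu : u ∈ closure s)
    (hGs : Set.EqOn G id s) : HasStrictFDerivAt G (ContinuousLinearMap.id ℝ E) u := by
  have h_fderiv : ∀ v ∈ s, fderiv ℝ G v ∈ ({ContinuousLinearMap.id ℝ E} : Set (E →L[ℝ] E)) :=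
    fun v hv => by rw [(hGs.eventuallyEq_of_mem (hs.mem_nhds hv)).fderiv_eq, fderiv_id]; rfl
  have h_cont : ContinuousAt (fderiv ℝ G) u :=
    (hG.fderiv_right (m := 0) (by simp)).continuousAt
  have h_mem := h_cont.continuousWithinAt.mem_closure hu h_fderiv
  rw [closure_singleton, Set.mem_singleton_iff] at h_mem
  exact h_mem ▸ hG.hasStrictFDerivAt one_ne_zero

theorem eventually_iterate_conj {X Y : Type*} [TopologicalSpace X] [TopologicalSpace Y]
    (φ : OpenPartialHomeomorph X Y) {x : X} (hx : x ∈ φ.source) {g : X → X} (hg : Continuous g)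
    (hgx : g x = x) (j : ℕ) :
    ∀ᶠ v in 𝓝 (φ x), (φ ∘ g ∘ φ.symm)^[j] v = φ (g^[j] (φ.symm v)) := by
  have h_symm : Filter.Tendsto φ.symm (𝓝 (φ x)) (𝓝 x) := φ.tendsto_symm hx
  induction j with
  | zero =>
    filter_upwards [φ.open_target.mem_nhds (φ.map_source hx)] with v hv
    exact (φ.right_inv hv).symm
  | succ j ih =>
    have h_source : ∀ᶠ v in 𝓝 (φ x), g^[j] (φ.symm v) ∈ φ.source :=
      (((hg.iterate j).tendsto' x x (Function.iterate_fixed hgx j)).comp h_symm).eventually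
        (φ.open_source.mem_nhds hx)
    filter_upwards [ih, h_source] with v hv hv_source
    rw [Function.iterate_succ_apply', hv, Function.iterate_succ_apply', Function.comp_apply,
      Function.comp_apply, φ.left_inv hv_source]

variable {E : Type*} [NormedAddCommGroup E] [NormedSpace ℝ E]
  {X : Type*} [TopologicalSpace X] [ChartedSpace E X] [IsManifold 𝓘(ℝ, E) 1 X] [T2Space X]
  {g : X → X}

theorem mem_interior_fixedPoints_of_mem_closure (hg : ContMDiff 𝓘(ℝ, E) 𝓘(ℝ, E) 1 g) {q : ℕ}
    (hq : q ≠ 0) (hgq : g^[q] = id) {x : X}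
    (hx : x ∈ closure (interior (Function.fixedPoints g))) :
    x ∈ interior (Function.fixedPoints g) := by
  have hgx : g x = x := (isClosed_fixedPoints hg.continuous).closure_subset_iff.2
    interior_subset hx
  set φ := chartAt E x
  have hxs : x ∈ φ.source := mem_chart_source E x
  have h_smooth : ContDiffAt ℝ 1 (φ ∘ g ∘ φ.symm) (φ x) := by
    rw [← contMDiffAt_iff_contDiffAt]
    have h_chart_symm : ContMDiffAt 𝓘(ℝ, E) 𝓘(ℝ, E) 1 φ.symm (φ x) :=
      (contMDiffOn_chart_symm (I := 𝓘(ℝ, E))).contMDiffAt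
        (φ.open_target.mem_nhds (φ.map_source hxs))
    have h_chart : ContMDiffAt 𝓘(ℝ, E) 𝓘(ℝ, E) 1 φ x :=
      (contMDiffOn_chart (I := 𝓘(ℝ, E))).contMDiffAt (φ.open_source.mem_nhds hxs)
    exact h_chart.comp_of_eq (hg.contMDiffAt.comp _ h_chart_symm) (by simp [φ.left_inv hxs, hgx])
  have h_strict := hasStrictFDerivAt_id_of_eqOn h_smooth
    (φ.isOpen_inter_preimage_symm isOpen_interior) (mem_closure_chart_target_inter hx)
    fun u hu => (congrArg φ (interior_subset (s := Function.fixedPoints g) hu.2)).trans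
      (φ.right_inv hu.1)
  have h_iterate : ∀ᶠ u in 𝓝 (φ x), (φ ∘ g ∘ φ.symm)^[q] u = u := by
    filter_upwards [eventually_iterate_conj φ hxs hg.continuous hgx q,
      φ.open_target.mem_nhds (φ.map_source hxs)] with u hu hu_target
    rw [hu, hgq, id, φ.right_inv hu_target]
  have h_fixed := eventually_eq_of_iterate_eventually_eq h_strict
    (by simp [φ.left_inv hxs, hgx]) hq h_iterate
  rw [mem_interior_iff_mem_nhds]
  filter_upwards [(φ.continuousAt hxs).eventually h_fixed, φ.open_source.mem_nhds hxs,
    (hg.continuous.tendsto' x x hgx).eventually (φ.open_source.mem_nhds hxs)] with y hy hys hgys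
  rw [Function.comp_apply, Function.comp_apply, φ.left_inv hys] at hy
  exact φ.injOn hgys hys hy

theorem eq_id_of_iterate_eq_id [PreconnectedSpace X] (hg : ContMDiff 𝓘(ℝ, E) 𝓘(ℝ, E) 1 g) {q : ℕ}
    (hq : q ≠ 0) (hgq : g^[q] = id) (h_fixed : (interior (Function.fixedPoints g)).Nonempty) :
    g = id := by
  have h_clopen : IsClopen (interior (Function.fixedPoints g)) :=
    ⟨isClosed_of_closure_subset fun _ => mem_interior_fixedPoints_of_mem_closure hg hq hgq,
      isOpen_interior⟩
  funext x
  exact interior_subset (s := Function.fixedPoints g)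
    (h_clopen.eq_univ h_fixed ▸ Set.mem_univ x)

end FiniteOrder

namespace IsSmoothAction

variable {E : Type*} [NormedAddCommGroup E] [NormedSpace ℝ E]
  {V : Type*} [NormedAddCommGroup V] [NormedSpace ℝ V]
  {X : Type*} [TopologicalSpace X] [ChartedSpace E X] {a : V → X → X}

/-- The group of the vectors which act trivially. -/
def kernel (ha : IsSmoothAction E a) : AddSubgroup V where
  carrier := {v | ∀ x, a v x = x}
  zero_mem' := ha.zero_act
  add_mem' hu hv x := by rw [ha.add_act, hv, hu]
  neg_mem' {v} hv x := by conv_lhs => rw [← hv x, ← ha.add_act, neg_add_cancel, ha.zero_act]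

theorem span_le_kernel {ι : Type*} (ha : IsSmoothAction E a) {b : ι → V}
    (hb : ∀ i, b i ∈ ha.kernel) {l : V} (hl : l ∈ Submodule.span ℤ (Set.range b)) :
    l ∈ ha.kernel :=
  Submodule.span_le (p := ha.kernel.toIntSubmodule).2 (Set.range_subset_iff.2 hb) hl

theorem iterate_act (ha : IsSmoothAction E a) (v : V) (j : ℕ) : (a v)^[j] = a (j • v) := by
  induction j with
  | zero => funext x; simp [ha.zero_act]
  | succ j ih => funext x; rw [Function.iterate_succ_apply, ih, ← ha.add_act, succ_nsmul]

variable [IsManifold 𝓘(ℝ, E) 1 X]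

-- Restricted to a complement of the Lie algebra of the stabilizer, the orbit map is an immersion.
theorem eventually_orbitDeriv_eq_zero_of_act_eq_self [FiniteDimensional ℝ V]
    (ha : IsSmoothAction E a) (x : X) : ∀ᶠ l in 𝓝 0, a l x = x → orbitDeriv E a x l = 0 := by
  set L : V →ₗ[ℝ] E := (orbitDeriv E a x : V →ₗ[ℝ] E)
  obtain ⟨S, hS⟩ := L.rangeRestrict.exists_rightInverse_of_surjective L.range_rangeRestrict
  have hLS : ∀ w, orbitDeriv E a x (S w) = w := fun w =>
    congrArg Subtype.val (LinearMap.congr_fun hS w)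
  have h_chart := mdifferentiable_chart (I := 𝓘(ℝ, E)) x
  set A : E →L[ℝ] E := realMFDeriv E E (chartAt E x) x
  have hA_inj : Function.Injective A := h_chart.mfderiv_injective (mem_chart_source E x)
  have h_section : HasMFDerivAt 𝓘(ℝ, LinearMap.range L) 𝓘(ℝ, V) S 0 S.toContinuousLinearMap :=
    S.toContinuousLinearMap.hasFDerivAt.hasMFDerivAt
  have h_deriv : HasFDerivAt (chartAt E x ∘ (fun u => a u x) ∘ S)
      (A.comp ((orbitDeriv E a x).comp S.toContinuousLinearMap)) 0 :=
    (hasMFDerivAt_comp_of_eq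
      (hasMFDerivAt_realMFDeriv (h_chart.mdifferentiableAt (mem_chart_source E x)))
      (hasMFDerivAt_comp_of_eq (ha.hasMFDerivAt_orbit x) h_section (map_zero S))
      (by simp [ha.zero_act])).hasFDerivAt
  have h_inj : Function.Injective (A.comp ((orbitDeriv E a x).comp S.toContinuousLinearMap)) :=
    hA_inj.comp fun w w' hw => Subtype.ext (by simpa [hLS] using hw)
  obtain ⟨C, -, hC⟩ := LinearMap.exists_antilipschitzWith
    (A.comp ((orbitDeriv E a x).comp S.toContinuousLinearMap) : LinearMap.range L →ₗ[ℝ] E)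
    (LinearMap.ker_eq_bot.2 h_inj)
  have h_ne := eventually_nhdsWithin_iff.1 (h_deriv.eventually_ne (c := chartAt E x x) ⟨C, hC⟩)
  filter_upwards [((LinearMap.continuous_of_finiteDimensional L.rangeRestrict).tendsto' 0 0
    (map_zero _)).eventually h_ne] with l hl h_fixed
  by_contra h_nonzero
  refine hl (fun h => h_nonzero (congrArg Subtype.val h)) ?_
  have h_ker : orbitDeriv E a x (S (L.rangeRestrict l) - l) = 0 := by
    rw [map_sub, hLS, LinearMap.codRestrict_apply]
    exact sub_self _
  have h_sub := ha.orbitDeriv_eq_zero_iff.1 h_ker 1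
  have h_section_fixed : a (S (L.rangeRestrict l)) x = x := by
    rw [← sub_add_cancel (S (L.rangeRestrict l)) l, ha.add_act, h_fixed]
    simpa using h_sub
  exact congrArg (chartAt E x) h_section_fixed

theorem exists_mem_span_orbitDeriv_eq_zero {ι : Type*} [Finite ι] (ha : IsSmoothAction E a)
    (b : Module.Basis ι ℝ V) (hb : ∀ i, b i ∈ ha.kernel) {x : X} {v : V} (hv_ne : v ≠ 0)
    (hv : orbitDeriv E a x v = 0) :
    ∃ l ∈ Submodule.span ℤ (Set.range b), l ≠ 0 ∧ orbitDeriv E a x l = 0 := by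
  have : FiniteDimensional ℝ V := b.finiteDimensional_of_finite
  obtain ⟨ε, hε, h_ball⟩ := Metric.eventually_nhds_iff.1
    (ha.eventually_orbitDeriv_eq_zero_of_act_eq_self x)
  obtain ⟨N, hN, l, hl, h_near⟩ := exists_nat_smul_near_span b v (lt_min hε (norm_pos_iff.2 hv_ne))
  have hNv : orbitDeriv E a x ((N : ℝ) • v) = 0 := by rw [map_smul, hv, smul_zero]
  refine ⟨l, hl, ?_, ?_⟩
  · rintro rfl
    have h_small : ‖(N : ℝ) • v‖ < ‖v‖ := by simpa using h_near.trans_le (min_le_right _ _)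
    rw [norm_smul, Real.norm_natCast] at h_small
    have hN_one : (1 : ℝ) ≤ N := by exact_mod_cast hN
    nlinarith [norm_nonneg v]
  · have h_fixed : a ((N : ℝ) • v - l) x = x := by
      rw [sub_eq_add_neg, ha.add_act, neg_mem (ha.span_le_kernel hb hl) x]
      exact ha.orbitDeriv_eq_zero_iff.1 hv N
    have h_sub := h_ball (by simpa using h_near.trans_le (min_le_left _ _)) h_fixed
    rwa [map_sub, hNv, zero_sub, neg_eq_zero] at h_sub

variable [T2Space X] [PreconnectedSpace X]

-- The rational multiples of `l` act by maps of finite order, which are the identity near a point.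
theorem orbitDeriv_eq_zero_of_isOpen (ha : IsSmoothAction E a) {l : V} (hl : l ∈ ha.kernel)
    {U : Set X} (hU : IsOpen U) (hU_ne : U.Nonempty) (hlU : ∀ x ∈ U, orbitDeriv E a x l = 0)
    (x : X) : orbitDeriv E a x l = 0 := by
  have h_rat : ∀ r : ℚ, a ((r : ℝ) • l) = id := fun r => by
    refine eq_id_of_iterate_eq_id ((ha.contMDiff_act _).of_le (by simp)) r.den_ne_zero ?_
      (hU_ne.mono (interior_maximal (fun y hy => ha.orbitDeriv_eq_zero_iff.1 (hlU y hy) _) hU))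
    have h_den : (r.den : ℝ) * r = r.num := by exact_mod_cast Rat.den_mul_eq_num r
    rw [ha.iterate_act, ← Nat.cast_smul_eq_nsmul ℝ, smul_smul, h_den, Int.cast_smul_eq_zsmul]
    exact funext (zsmul_mem hl r.num)
  have h_cont : Continuous fun s : ℝ => a (s • l) x :=
    (ha.contMDiff_orbit x).continuous.comp (continuous_id.smul continuous_const)
  exact ha.orbitDeriv_eq_zero_iff.2 <| congrFun <|
    Rat.denseRange_cast.equalizer h_cont continuous_const (funext fun r => congrFun (h_rat r) x)

theorem dense_injective_orbitDeriv [BaireSpace X] {ι : Type*} [Finite ι] (ha : IsSmoothAction E a)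
    (b : Module.Basis ι ℝ V) (hb : ∀ i, b i ∈ ha.kernel)
    (h_eff : ∀ v : V, (∀ x, orbitDeriv E a x v = 0) → v = 0) :
    Dense {x | Function.Injective (orbitDeriv E a x)} := by
  have : FiniteDimensional ℝ V := b.finiteDimensional_of_finite
  have h_dense : Dense (⋂ l : {l : Submodule.span ℤ (Set.range b) // l ≠ 0},
      {x | orbitDeriv E a x l.1 = 0}ᶜ) := by
    refine dense_iInter_of_isOpen (fun l => ?_) (fun l => ?_)
    · simp only [isOpen_compl_iff, ha.orbitDeriv_eq_zero_iff, Set.ofPred_forall]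
      exact isClosed_iInter fun s => isClosed_eq (ha.contMDiff_act _).continuous continuous_id
    · rw [← interior_eq_empty_iff_dense_compl, ← Set.not_nonempty_iff_eq_empty]
      refine fun h_ne => l.2 (Subtype.ext (h_eff _ ?_))
      exact ha.orbitDeriv_eq_zero_of_isOpen (ha.span_le_kernel hb l.1.2) isOpen_interior h_ne
        fun x hx => interior_subset (s := {x | orbitDeriv E a x l.1 = 0}) hx
  refine h_dense.mono fun x hx => (injective_iff_map_eq_zero _).2 fun v hv => ?_
  by_contra hv_ne
  obtain ⟨l, hl, hl_ne, hl_zero⟩ := ha.exists_mem_span_orbitDeriv_eq_zero b hb hv_ne hv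
  exact Set.mem_iInter.1 hx ⟨⟨l, hl⟩, fun h => hl_ne (congrArg Subtype.val h)⟩ hl_zero

end IsSmoothAction

section Contraction

variable {E : Type*} [NormedAddCommGroup E] [NormedSpace ℝ E]

theorem alternating_pair_swap (η : E [⋀^Fin 2]→L[ℝ] ℝ) (v w : E) : η ![v, w] = -η ![w, v] := by
  have h_swap := η.toAlternatingMap.map_swap ![w, v] (i := 0) (j := 1) (by simp)
  have h_vec : ![w, v] ∘ Equiv.swap (0 : Fin 2) 1 = ![v, w] := by
    funext i
    fin_cases i <;> simp
  rwa [h_vec] at h_swap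

/-- The contraction `v ↦ ι_v η` of a 2-form with vectors. -/
noncomputable def contraction (η : E [⋀^Fin 2]→L[ℝ] ℝ) : E →L[ℝ] E →L[ℝ] ℝ :=
  ((ContinuousAlternatingMap.ofSubsingletonLIE (𝕜 := ℝ) (E := E) (F := ℝ) (0 : Fin 1)).symm :
    (E [⋀^Fin 1]→L[ℝ] ℝ) →L[ℝ] E →L[ℝ] ℝ).comp η.curryLeft

theorem contraction_apply (η : E [⋀^Fin 2]→L[ℝ] ℝ) (v w : E) :
    contraction η v w = η ![v, w] := by
  change η (Matrix.vecCons v fun _ => w) = η ![v, w]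
  congr 1
  funext i
  fin_cases i <;> rfl

theorem bijective_of_injective_dual [FiniteDimensional ℝ E] {K : E →L[ℝ] E →L[ℝ] ℝ}
    (hK : Function.Injective K) : Function.Bijective K := by
  have h_finrank : Module.finrank ℝ E = Module.finrank ℝ (E →L[ℝ] ℝ) :=
    (Subspace.dual_finrank_eq (K := ℝ)).symm.trans LinearMap.toContinuousLinearMap.finrank_eq
  exact ⟨hK, (LinearMap.injective_iff_surjective_of_finrank_eq_finrank
    (f := (K : E →ₗ[ℝ] E →L[ℝ] ℝ)) h_finrank).1 hK⟩

end Contraction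

theorem apply_I_smul_eq_zero_of_mem_span {E ι κ : Type*} [NormedAddCommGroup E]
    [NormedSpace ℂ E] {v : ι → E} {α : κ → E →L[ℂ] ℂ}
    (h_zero : ∀ j i, α j (v i) = 0) {φ : E →L[ℝ] ℝ}
    (hφ : φ ∈ Submodule.span ℝ (Set.range fun j => Complex.reCLM.comp ((α j).restrictScalars ℝ)))
    {w : E} (hw : w ∈ Submodule.span ℝ (Set.range v)) : φ (Complex.I • w) = 0 := by
  induction hφ using Submodule.span_induction with
  | mem φ hφ =>
    obtain ⟨j, rfl⟩ := hφ
    have hw_ker : Submodule.span ℝ (Set.range v) ≤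
        LinearMap.ker ((α j).restrictScalars ℝ : E →ₗ[ℝ] ℂ) :=
      Submodule.span_le.2 (Set.range_subset_iff.2 (h_zero j))
    have hw_zero : α j w = 0 := hw_ker hw
    simp [hw_zero]
  | zero => rfl
  | add φ ψ _ _ hφ hψ => rw [add_apply, hφ, hψ, add_zero]
  | smul c φ _ hφ => rw [smul_apply, hφ, smul_zero]

/-- A real 2-form on a complex vector space is taming if it is positive on every complex line. -/
def IsTaming {E : Type*} [NormedAddCommGroup E] [NormedSpace ℂ E] (η : E [⋀^Fin 2]→L[ℝ] ℝ) :
    Prop :=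
  ∀ v : E, v ≠ 0 → 0 < η ![v, Complex.I • v]

namespace IsTaming

variable {E : Type*} [NormedAddCommGroup E] [NormedSpace ℂ E] {η : E [⋀^Fin 2]→L[ℝ] ℝ}

theorem eq_zero (hη : IsTaming η) {v : E} (hv : η ![v, Complex.I • v] = 0) : v = 0 := by
  by_contra h_ne
  exact (hη v h_ne).ne' hv

theorem contraction_injective (hη : IsTaming η) : Function.Injective (contraction η) := by
  refine (injective_iff_map_eq_zero _).2 fun v hv => hη.eq_zero ?_
  rw [← contraction_apply, hv, zero_apply]

theorem contraction_bijective [FiniteDimensional ℂ E] (hη : IsTaming η) :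
    Function.Bijective (contraction η) :=
  bijective_of_injective_dual hη.contraction_injective

theorem exists_sub_orthogonal [FiniteDimensional ℂ E] (hη : IsTaming η) (K : Submodule ℂ E)
    (w : E) : ∃ z ∈ K, ∀ v ∈ K, η ![w - z, v] = 0 := by
  let ι : K →L[ℝ] E := K.subtypeL.restrictScalars ℝ
  have h_restrict : ∀ z v : K, η.compContinuousLinearMap ι ![z, v] = η ![(z : E), (v : E)] :=
    fun z v => by
      rw [ContinuousAlternatingMap.compContinuousLinearMap_apply]
      congr 1
      funext i
      fin_cases i <;> rfl
  have h_taming : IsTaming (η.compContinuousLinearMap ι) := fun z hz => by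
    rw [h_restrict]
    exact hη z fun h => hz (Subtype.ext h)
  obtain ⟨z, hz⟩ := h_taming.contraction_bijective.2 ((contraction η w).comp ι)
  refine ⟨z, z.2, fun v hv => ?_⟩
  have h_eq : η ![(z : E), v] = η ![w, v] := by
    have h_apply := DFunLike.congr_fun hz (⟨v, hv⟩ : K)
    rwa [contraction_apply, h_restrict, ContinuousLinearMap.comp_apply, contraction_apply]
      at h_apply
  rw [← contraction_apply, map_sub, sub_apply, contraction_apply, contraction_apply, h_eq, sub_self]

theorem exists_orthogonal_ker_lift [FiniteDimensional ℂ E] (hη : IsTaming η) {E' : Type*}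
    [AddCommGroup E'] [Module ℂ E'] {A : E →ₗ[ℂ] E'} (hA : Function.Surjective A) (u : E') :
    ∃ w, A w = u ∧ ∀ v, A v = 0 → η ![w, v] = 0 := by
  obtain ⟨w, rfl⟩ := hA u
  obtain ⟨z, hz, h_orth⟩ := hη.exists_sub_orthogonal (LinearMap.ker A) w
  exact ⟨w - z, by rw [map_sub, LinearMap.mem_ker.1 hz, sub_zero], h_orth⟩

-- Write a complex relation as `A + iB = 0` with `A` and `B` real combinations of the `v i`; then
-- `η(B, iB) = -η(B, A) = 0`.
theorem linearIndependent_complex (hη : IsTaming η) {ι : Type*} {v : ι → E}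
    (hv : LinearIndependent ℝ v) (h_iso : ∀ i j, η ![v i, v j] = 0) : LinearIndependent ℂ v := by
  rw [linearIndependent_iff'] at hv ⊢
  intro s c hc
  set A := ∑ i ∈ s, (c i).re • v i with hA
  set B := ∑ i ∈ s, (c i).im • v i with hB
  have h_rel : A + Complex.I • B = 0 := by
    rw [← hc, hA, hB, Finset.smul_sum, ← Finset.sum_add_distrib]
    refine Finset.sum_congr rfl fun i _ => ?_
    conv_rhs => rw [← Complex.re_add_im (c i)]
    rw [add_smul, mul_comm, mul_smul, Complex.coe_smul, Complex.coe_smul]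
  have h_BA : contraction η B A = 0 := by
    simp only [hA, hB, map_sum, map_smul, sum_apply, smul_apply, contraction_apply, h_iso,
      smul_zero, Finset.sum_const_zero]
  have hB_zero : B = 0 := hη.eq_zero <| by
    rw [← contraction_apply, eq_neg_of_add_eq_zero_right h_rel, map_neg, h_BA, neg_zero]
  have hA_zero : A = 0 := by simpa [hB_zero] using h_rel
  exact fun i hi => Complex.ext (hv s _ hA_zero i hi) (hv s _ hB_zero i hi)

theorem linearIndependent_contraction_sumElim_re (hη : IsTaming η) {ι κ : Type*} {v : ι → E}
    (hv : LinearIndependent ℝ v) {α : κ → E →L[ℂ] ℂ} (hα : LinearIndependent ℂ α)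
    (h_zero : ∀ j i, α j (v i) = 0) :
    LinearIndependent ℝ (Sum.elim (fun i => contraction η (v i))
      fun j => Complex.reCLM.comp ((α j).restrictScalars ℝ)) := by
  refine LinearIndependent.sum_type ?_ ?_ ?_
  · exact hv.map' (contraction η : E →ₗ[ℝ] E →L[ℝ] ℝ)
      (LinearMap.ker_eq_bot.2 hη.contraction_injective)
  · exact (hα.restrict_scalars' ℝ).map'
      (StrongDual.extendRCLikeₗ (𝕜 := ℂ) (F := E)).symm.toLinearMap
      (LinearEquiv.ker _)
  · rw [Submodule.disjoint_def]
    intro φ hφ_contraction hφ_re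
    rw [Set.range_comp' (contraction η), ← ContinuousLinearMap.coe_coe, ← Submodule.map_span]
      at hφ_contraction
    obtain ⟨w, hw, rfl⟩ := hφ_contraction
    have hw_zero : w = 0 := hη.eq_zero <|
      (contraction_apply η w _).symm.trans (apply_I_smul_eq_zero_of_mem_span h_zero hφ_re hw)
    rw [hw_zero, map_zero]

end IsTaming

section LinearAlgebra

theorem linearIndependent_append {R V : Type*} [Ring R] [AddCommGroup V] [Module R V] {k m : ℕ}
    {v : Fin k → V} {w : Fin m → V} :
    LinearIndependent R (Fin.append v w) ↔ LinearIndependent R (Sum.elim v w) := by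
  rw [← Fin.append_comp_sumElim]
  exact (linearIndependent_equiv finSumFinEquiv).symm

theorem linearIndependent_append_rev {R V : Type*} [Ring R] [AddCommGroup V] [Module R V] {k m : ℕ}
    {ξ : Fin (k + m) → V} (hξ : LinearIndependent R ξ) :
    LinearIndependent R
      (Fin.append (fun i => ξ (Fin.castAdd m i.rev)) fun j => ξ (Fin.natAdd k j)) := by
  rw [← Fin.append_castAdd_natAdd (f := ξ), linearIndependent_append] at hξ
  rw [linearIndependent_append]
  have h_rev := hξ.comp (Sum.map Fin.rev id)
    (Sum.map_injective.2 ⟨Fin.rev_injective, Function.injective_id⟩)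
  rwa [Sum.elim_comp_map] at h_rev

theorem exists_linearIndependent_append {K V : Type*} [DivisionRing K] [AddCommGroup V]
    [Module K V] {k : ℕ} {v : Fin k → V} (hv : LinearIndependent K v) :
    ∀ {m : ℕ}, k + m ≤ Module.finrank K V →
      ∃ w : Fin m → V, LinearIndependent K (Fin.append v w)
  | 0, _ => ⟨Fin.elim0, by rwa [Fin.append_elim0]⟩
  | m + 1, h_finrank => by
    obtain ⟨w, hw⟩ := exists_linearIndependent_append hv (m := m) (by omega)
    obtain ⟨x, hx⟩ := exists_linearIndependent_snoc_of_lt_finrank hw (by omega)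
    exact ⟨Fin.snoc w x, by rwa [Fin.append_snoc]⟩

theorem alternatingMap_eq_zero_of_mem_span {R V ι : Type*} [CommRing R] [AddCommGroup V]
    [Module R V] [Finite ι] {f : V [⋀^ι]→ₗ[R] R} {e : ι → V} (hf : f e = 0) {v : ι → V}
    (hv : ∀ i, v i ∈ Submodule.span R (Set.range e)) : f v = 0 := by
  have := Fintype.ofFinite ι
  have h_comp : f.compLinearMap (Fintype.linearCombination R e) = 0 := by
    rw [← AlternatingMap.map_basis_eq_zero_iff (Pi.basisFun R ι)]
    have h_basis : (fun i => Fintype.linearCombination R e (Pi.basisFun R ι i)) = e := by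
      classical simp [Fintype.linearCombination_apply_single]
    exact (congrArg f h_basis).trans hf
  choose c hc using fun i => (Submodule.mem_span_range_iff_exists_fun R).1 (hv i)
  simpa [Function.comp_def, Fintype.linearCombination_apply, hc] using DFunLike.congr_fun h_comp c

theorem surjective_iff_linearIndependent_proj_comp {V ι : Type*} [NormedAddCommGroup V]
    [NormedSpace ℝ V] [Finite ι] {L : V →L[ℝ] ι → ℝ} :
    Function.Surjective L ↔ LinearIndependent ℝ fun i =>
      (ContinuousLinearMap.proj (R := ℝ) (φ := fun _ : ι => ℝ) i).comp L := by
  have := Fintype.ofFinite ι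
  rw [← (LinearMap.ltoFun ℝ V ℝ ℝ ∘ₗ ContinuousLinearMap.coeLM ℝ).linearIndependent_iff_of_injOn
    (DFunLike.coe_injective.injOn), ← span_flip_eq_top_iff_linearIndependent]
  change _ ↔ Submodule.span ℝ (Set.range L) = ⊤
  rw [← ContinuousLinearMap.coe_coe, ← LinearMap.coe_range, Submodule.span_eq,
    LinearMap.range_eq_top]

theorem isOpen_surjective {V ι : Type*} [NormedAddCommGroup V] [NormedSpace ℝ V] [Finite ι] :
    IsOpen {L : V →L[ℝ] ι → ℝ | Function.Surjective L} := by
  have := Fintype.ofFinite ι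
  simp only [surjective_iff_linearIndependent_proj_comp]
  exact isOpen_setOfPred_linearIndependent.preimage (f := fun L : V →L[ℝ] ι → ℝ => fun i =>
    (ContinuousLinearMap.proj (R := ℝ) (φ := fun _ : ι => ℝ) i).comp L)
    (continuous_pi fun i => continuous_const.clm_comp continuous_id)

theorem exists_append_apply_ne_zero {K V : Type*} [Field K] [AddCommGroup V] [Module K V]
    [FiniteDimensional K V] {k m : ℕ} (h_finrank : Module.finrank K V = k + m)
    {f : V [⋀^Fin (k + m)]→ₗ[K] K} (hf : f ≠ 0) {v : Fin k → V} (hv : LinearIndependent K v) :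
    ∃ w : Fin m → V, f (Fin.append v w) ≠ 0 := by
  obtain ⟨w, hw⟩ := exists_linearIndependent_append hv h_finrank.ge
  have h_span := hw.span_eq_top_of_card_eq_finrank' (by rw [Fintype.card_fin, h_finrank])
  refine ⟨w, fun h_zero => hf (AlternatingMap.ext fun u => ?_)⟩
  exact alternatingMap_eq_zero_of_mem_span h_zero fun i => h_span ▸ Submodule.mem_top

end LinearAlgebra

section Wedge

variable {E : Type*} [NormedAddCommGroup E] [NormedSpace ℂ E] {m : ℕ}

theorem linearIndependent_of_wedgeApply_ne_zero {α : Fin m → E →L[ℂ] ℂ} {w : Fin m → E}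
    (h : wedgeApply α w ≠ 0) : LinearIndependent ℂ α := by
  let eval : (E →L[ℂ] ℂ) →ₗ[ℂ] Fin m → ℂ :=
    LinearMap.pi fun j => (ContinuousLinearMap.apply ℂ ℂ (w j) : (E →L[ℂ] ℂ) →ₗ[ℂ] ℂ)
  exact LinearIndependent.of_comp eval (Matrix.linearIndependent_rows_of_det_ne_zero h)

theorem surjective_of_wedgeApply_comp_ne_zero {E' : Type*} [NormedAddCommGroup E']
    [NormedSpace ℂ E'] [FiniteDimensional ℂ E'] (hE' : Module.finrank ℂ E' = m)
    {A : E →L[ℂ] E'} {β : Fin m → E' →L[ℂ] ℂ} {w : Fin m → E}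
    (h : wedgeApply (fun j => (β j).comp A) w ≠ 0) : Function.Surjective A := by
  let eval : E' →ₗ[ℂ] Fin m → ℂ := LinearMap.pi fun i => (β i : E' →ₗ[ℂ] ℂ)
  have hw : LinearIndependent ℂ (A ∘ w) :=
    LinearIndependent.of_comp eval (Matrix.linearIndependent_cols_of_det_ne_zero h)
  have h_span : Submodule.span ℂ (Set.range (A ∘ w)) ≤ LinearMap.range (A : E →ₗ[ℂ] E') :=
    Submodule.span_le.2 (Set.range_comp_subset_range w A)
  rw [hw.span_eq_top_of_card_eq_finrank' (by rw [Fintype.card_fin, hE']), top_le_iff] at h_span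
  exact LinearMap.range_eq_top.1 h_span

theorem im_phase_mul_wedgeApply {α : Fin m → E →L[ℂ] ℂ} {w : Fin m → E}
    (h_re : ∀ i j, (α i (w j)).re = 0) :
    (Complex.exp ((-(m * (Real.pi / 2)) : ℝ) * Complex.I) * wedgeApply α w).im = 0 := by
  let M : Matrix (Fin m) (Fin m) ℝ := Matrix.of fun i j => (α i (w j)).im
  have h_matrix : (Matrix.of fun i j => α i (w j)) = Complex.I • M.map Complex.ofRealHom := by
    ext i j
    apply Complex.ext <;> simp [M, h_re]
  have h_det : (M.map Complex.ofRealHom).det = (M.det : ℂ) := (RingHom.map_det _ M).symm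
  have h_exp : Complex.exp ((-(m * (Real.pi / 2)) : ℝ) * Complex.I) = (-Complex.I) ^ m := by
    rw [show ((-(m * (Real.pi / 2)) : ℝ) : ℂ) * Complex.I = m * -(Real.pi / 2 * Complex.I) by
      push_cast; ring, Complex.exp_nat_mul, Complex.exp_neg, Complex.exp_pi_div_two_mul_I,
      Complex.inv_I]
  rw [wedgeApply, h_matrix, Matrix.det_smul, Fintype.card_fin, h_exp, ← mul_assoc, ← mul_pow, h_det]
  simp

end Wedge

section Kernel

variable {E : Type*} [NormedAddCommGroup E] [NormedSpace ℂ E]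
  {η : E [⋀^Fin 2]→L[ℝ] ℝ} {n : ℕ} {L : E →L[ℝ] Fin n → ℝ}

theorem linearIndependent_of_surjective {ξ : Fin n → E} (hL : Function.Surjective L)
    (hξ : ∀ i v, η ![ξ i, v] = L v i) : LinearIndependent ℝ ξ := by
  refine LinearIndependent.of_comp (contraction η : E →ₗ[ℝ] E →L[ℝ] ℝ) ?_
  convert surjective_iff_linearIndependent_proj_comp.1 hL using 1
  funext i
  ext v
  exact (contraction_apply η (ξ i) v).trans (hξ i v)

variable [FiniteDimensional ℂ E]

theorem span_eq_ker_of_surjective (hE : Module.finrank ℂ E = n) (hL : Function.Surjective L)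
    {e : Fin n → E} (he : LinearIndependent ℝ e) (heL : ∀ i, L (e i) = 0) :
    Submodule.span ℝ (Set.range e) = LinearMap.ker (L : E →ₗ[ℝ] Fin n → ℝ) := by
  have h_rank := LinearMap.finrank_range_add_finrank_ker (L : E →ₗ[ℝ] Fin n → ℝ)
  rw [LinearMap.range_eq_top.2 hL, finrank_top, finrank_real_of_complex, hE, Module.finrank_fin_fun]
    at h_rank
  refine Submodule.eq_of_le_of_finrank_eq (Submodule.span_le.2 (Set.range_subset_iff.2 heL)) ?_
  rw [finrank_span_eq_card he, Fintype.card_fin]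
  omega

theorem apply_eq_zero_of_ker (hE : Module.finrank ℂ E = n) (hL : Function.Surjective L)
    {ξ : Fin n → E} (hξ : ∀ i v, η ![ξ i, v] = L v i) (h_comm : ∀ i, L (ξ i) = 0) {v w : E}
    (hv : L v = 0) (hw : L w = 0) : η ![v, w] = 0 := by
  have h_span := span_eq_ker_of_surjective hE hL (linearIndependent_of_surjective hL hξ) h_comm
  have h_le : Submodule.span ℝ (Set.range ξ) ≤
      LinearMap.ker ((contraction η).flip w : E →ₗ[ℝ] ℝ) :=
    Submodule.span_le.2 <| Set.range_subset_iff.2 fun i => by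
      change contraction η (ξ i) w = 0
      rw [contraction_apply, hξ, hw, Pi.zero_apply]
  have hv_zero : contraction η v w = 0 := h_le (h_span ▸ hv)
  rwa [contraction_apply] at hv_zero

theorem im_mul_eq_zero_of_ker (hE : Module.finrank ℂ E = n) (hL : Function.Surjective L)
    {e : Fin n → E} (he : LinearIndependent ℝ e) (heL : ∀ i, L (e i) = 0)
    {Ω : E [⋀^Fin n]→L[ℂ] ℂ} {z : ℂ} (hz : (z * Ω e).im = 0) {v : Fin n → E}
    (hv : ∀ i, L (v i) = 0) : (z * Ω v).im = 0 :=
  alternatingMap_eq_zero_of_mem_span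
    (f := (Complex.imLm ∘ₗ LinearMap.mulLeft ℝ z).compAlternatingMap
      (Ω.restrictScalars ℝ).toAlternatingMap)
    hz fun i => span_eq_ker_of_surjective hE hL he heL ▸ hv i

end Kernel

section Hamiltonian

variable {E : Type*} [NormedAddCommGroup E] [NormedSpace ℂ E]
  {X : Type*} [TopologicalSpace X] [ChartedSpace E X] {κ : X → E [⋀^Fin 2]→L[ℝ] ℝ}
  {g h : X → ℝ} {x : X}

theorem isHamiltonianVector_iff {v : E} :
    IsHamiltonianVector κ h x v ↔ contraction (κ x) v = realMFDeriv E ℝ h x :=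
  ⟨fun hv => ContinuousLinearMap.ext fun w => (contraction_apply (κ x) v w).trans (hv w),
    fun hv w => (contraction_apply (κ x) v w).symm.trans (DFunLike.congr_fun hv w)⟩

theorem isHamiltonianVector_congr {h' : X → ℝ} (h_eq : h' =ᶠ[𝓝 x] h) {v : E} :
    IsHamiltonianVector κ h' x v ↔ IsHamiltonianVector κ h x v := by
  rw [isHamiltonianVector_iff, isHamiltonianVector_iff, realMFDeriv, h_eq.mfderiv_eq, realMFDeriv]

theorem PoissonCommuteAt.symm (hgh : PoissonCommuteAt κ g h x) : PoissonCommuteAt κ h g x :=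
  fun v w hv hw => by rw [alternating_pair_swap, hgh w v hw hv, neg_zero]

theorem IsKahlerForm.isTaming (hκ : IsKahlerForm κ) (x : X) : IsTaming (κ x) :=
  hκ.pos x

variable [FiniteDimensional ℂ E]

theorem IsKahlerForm.exists_isHamiltonianVector (hκ : IsKahlerForm κ) (h : X → ℝ) (x : X) :
    ∃ v : E, IsHamiltonianVector κ h x v := by
  simp only [isHamiltonianVector_iff]
  exact (hκ.isTaming x).contraction_bijective.2 (realMFDeriv E ℝ h x)

theorem IsKahlerForm.poissonCommuteAt_iff (hκ : IsKahlerForm κ) {w : E}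
    (hw : IsHamiltonianVector κ h x w) :
    PoissonCommuteAt κ g h x ↔ realMFDeriv E ℝ g x w = 0 := by
  refine ⟨fun hgh => ?_, fun h_zero v w' hv hw' => ?_⟩
  · obtain ⟨v, hv⟩ := hκ.exists_isHamiltonianVector g x
    exact (hv w).symm.trans (hgh v w hv hw)
  · have h_unique : w' = w := (hκ.isTaming x).contraction_injective
      ((isHamiltonianVector_iff.1 hw').trans (isHamiltonianVector_iff.1 hw).symm)
    exact h_unique ▸ (hv w').trans (h_unique ▸ h_zero)

end Hamiltonian

section PoissonBracket

variable {E : Type*} [NormedAddCommGroup E] [NormedSpace ℂ E]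
  {X : Type*} [TopologicalSpace X] [ChartedSpace E X] {κ : X → E [⋀^Fin 2]→L[ℝ] ℝ}

theorem contraction_formInChart (x₀ : X) (u v w : E) :
    contraction (formInChart ℝ κ x₀ u) v w =
      contraction (κ ((chartAt E x₀).symm u)) (realMFDeriv E E (chartAt E x₀).symm u v)
        (realMFDeriv E E (chartAt E x₀).symm u w) := by
  rw [contraction_apply, contraction_apply]
  change κ _ (realMFDeriv E E (chartAt E x₀).symm u ∘ ![v, w]) = _
  congr 1
  funext i
  fin_cases i <;> rfl

theorem isHamiltonianVector_of_chart [IsManifold 𝓘(ℝ, E) 1 X] {h : X → ℝ} (x₀ : X) {u : E}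
    (hu : u ∈ (chartAt E x₀).target)
    (hh : MDifferentiableAt 𝓘(ℝ, E) 𝓘(ℝ, ℝ) h ((chartAt E x₀).symm u)) {v : E}
    (hv : contraction (formInChart ℝ κ x₀ u) v = fderiv ℝ (h ∘ (chartAt E x₀).symm) u) :
    IsHamiltonianVector κ h ((chartAt E x₀).symm u) (realMFDeriv E E (chartAt E x₀).symm u v) := by
  rw [fderiv_comp_chart_symm x₀ hu hh] at hv
  refine isHamiltonianVector_iff.2 (ContinuousLinearMap.ext
    ((bijective_realMFDeriv_chart_symm x₀ hu).2.forall.2 fun w => ?_))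
  exact (contraction_formInChart x₀ u v w).symm.trans (DFunLike.congr_fun hv w)

variable [FiniteDimensional ℂ E]

theorem IsKahlerForm.continuousOn_contraction_formInChart (hκ : IsKahlerForm κ) (x₀ : X) :
    ContinuousOn (fun u => contraction (formInChart ℝ κ x₀ u)) (chartAt E x₀).target := by
  simp only [continuousOn_clm_apply, contraction_apply]
  exact fun v w => (ContinuousAlternatingMap.apply ℝ E ℝ ![v, w]).continuous.comp_continuousOn
    (hκ.smooth x₀).continuousOn

variable [IsManifold 𝓘(ℝ, E) 1 X]

theorem IsKahlerForm.isInvertible_contraction_formInChart (hκ : IsKahlerForm κ) (x₀ : X) {u : E}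
    (hu : u ∈ (chartAt E x₀).target) : (contraction (formInChart ℝ κ x₀ u)).IsInvertible := by
  have h_chart := bijective_realMFDeriv_chart_symm x₀ hu
  have h_inj : Function.Injective (contraction (formInChart ℝ κ x₀ u)) := by
    refine (injective_iff_map_eq_zero _).2 fun v hv => ?_
    apply (injective_iff_map_eq_zero (realMFDeriv E E (chartAt E x₀).symm u)).1 h_chart.1
    refine (injective_iff_map_eq_zero (contraction (κ ((chartAt E x₀).symm u)))).1
      (hκ.isTaming _).contraction_injective _
      (ContinuousLinearMap.ext (h_chart.2.forall.2 fun w => ?_))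
    exact (contraction_formInChart x₀ u v w).symm.trans (DFunLike.congr_fun hv w)
  exact ⟨(LinearEquiv.ofBijective (contraction (formInChart ℝ κ x₀ u) : E →ₗ[ℝ] E →L[ℝ] ℝ)
    (bijective_of_injective_dual h_inj)).toContinuousLinearEquiv, rfl⟩

/-- The Poisson bracket `{g, h}` in the chart around `x₀`, written as the derivative of `g` along
the Hamiltonian vector field of `h`. -/
noncomputable def poissonBracketInChart (κ : X → E [⋀^Fin 2]→L[ℝ] ℝ) (g h : X → ℝ) (x₀ : X)
    (u : E) : ℝ :=
  fderiv ℝ (g ∘ (chartAt E x₀).symm) u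
    ((contraction (formInChart ℝ κ x₀ u)).inverse (fderiv ℝ (h ∘ (chartAt E x₀).symm) u))

variable {g h : X → ℝ} {U : Set X}

theorem IsKahlerForm.poissonCommuteAt_iff_poissonBracketInChart (hκ : IsKahlerForm κ) (x₀ : X)
    {u : E} (hu : u ∈ (chartAt E x₀).target)
    (hg : MDifferentiableAt 𝓘(ℝ, E) 𝓘(ℝ, ℝ) g ((chartAt E x₀).symm u))
    (hh : MDifferentiableAt 𝓘(ℝ, E) 𝓘(ℝ, ℝ) h ((chartAt E x₀).symm u)) :
    PoissonCommuteAt κ g h ((chartAt E x₀).symm u) ↔ poissonBracketInChart κ g h x₀ u = 0 := by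
  have h_ham := isHamiltonianVector_of_chart x₀ hu hh
    ((hκ.isInvertible_contraction_formInChart x₀ hu).inverse_apply_eq.1 rfl).symm
  rw [hκ.poissonCommuteAt_iff h_ham, poissonBracketInChart, fderiv_comp_chart_symm x₀ hu hg,
    ContinuousLinearMap.comp_apply]

theorem IsKahlerForm.continuousOn_poissonBracketInChart (hκ : IsKahlerForm κ) (hU : IsOpen U)
    (hg : ContMDiffOn 𝓘(ℝ, E) 𝓘(ℝ, ℝ) 1 g U) (hh : ContMDiffOn 𝓘(ℝ, E) 𝓘(ℝ, ℝ) 1 h U) (x₀ : X) :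
    ContinuousOn (poissonBracketInChart κ g h x₀)
      ((chartAt E x₀).target ∩ (chartAt E x₀).symm ⁻¹' U) := by
  have := FiniteDimensional.complete ℂ E
  have h_inverse : ContinuousOn (fun u => (contraction (formInChart ℝ κ x₀ u)).inverse)
      ((chartAt E x₀).target ∩ (chartAt E x₀).symm ⁻¹' U) := fun u hu => by
    have h_at : ContinuousAt ContinuousLinearMap.inverse (contraction (formInChart ℝ κ x₀ u)) :=
      ((hκ.isInvertible_contraction_formInChart x₀ hu.1).contDiffAt_map_inverse
        (n := 0)).continuousAt
    exact h_at.comp_continuousWithinAt (f := fun u => contraction (formInChart ℝ κ x₀ u))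
      ((hκ.continuousOn_contraction_formInChart x₀ u hu.1).mono Set.inter_subset_left)
  exact (continuousOn_fderiv_comp_chart_symm hU hg x₀).clm_apply
    (h_inverse.clm_apply (continuousOn_fderiv_comp_chart_symm hU hh x₀))

theorem IsKahlerForm.poissonCommuteAt_of_mem_closure (hκ : IsKahlerForm κ) (hU : IsOpen U)
    (hg : ContMDiffOn 𝓘(ℝ, E) 𝓘(ℝ, ℝ) 1 g U) (hh : ContMDiffOn 𝓘(ℝ, E) 𝓘(ℝ, ℝ) 1 h U)
    {S : Set X} (hSU : S ⊆ U) (hS : ∀ x ∈ S, PoissonCommuteAt κ g h x) {x : X} (hxU : x ∈ U)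
    (hx : x ∈ closure S) : PoissonCommuteAt κ g h x := by
  have h_iff : ∀ u ∈ (chartAt E x).target ∩ (chartAt E x).symm ⁻¹' U,
      PoissonCommuteAt κ g h ((chartAt E x).symm u) ↔ poissonBracketInChart κ g h x u = 0 :=
    fun u hu => hκ.poissonCommuteAt_iff_poissonBracketInChart x hu.1
      ((hg.contMDiffAt (hU.mem_nhds hu.2)).mdifferentiableAt one_ne_zero)
      ((hh.contMDiffAt (hU.mem_nhds hu.2)).mdifferentiableAt one_ne_zero)
  have h_left_inv := (chartAt E x).left_inv (mem_chart_source E x)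
  have hx_mem : chartAt E x x ∈ (chartAt E x).target ∩ (chartAt E x).symm ⁻¹' U :=
    ⟨mem_chart_target E x, by rwa [Set.mem_preimage, h_left_inv]⟩
  have h_bracket : poissonBracketInChart κ g h x (chartAt E x x) ∈ ({0} : Set ℝ) := by
    rw [← isClosed_singleton.closure_eq]
    exact ((hκ.continuousOn_poissonBracketInChart hU hg hh x _ hx_mem).mono
      (Set.inter_subset_inter_right _ (Set.preimage_mono hSU))).mem_closure
      (mem_closure_chart_target_inter hx) fun u hu => (h_iff u ⟨hu.1, hSU hu.2⟩).1 (hS _ hu.2)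
  rw [← h_left_inv]
  exact (h_iff _ hx_mem).2 h_bracket

end PoissonBracket

section RegularLocus

variable {E : Type*} [NormedAddCommGroup E] [NormedSpace ℂ E]
  {X : Type*} [TopologicalSpace X] [ChartedSpace E X] [IsManifold 𝓘(ℝ, E) 1 X]
  {n : ℕ} {ρ : X → Fin n → ℝ}

theorem surjective_fderiv_comp_chart_symm_iff (x₀ : X) {u : E}
    (hu : u ∈ (chartAt E x₀).target)
    (hρ : MDifferentiableAt 𝓘(ℝ, E) 𝓘(ℝ, Fin n → ℝ) ρ ((chartAt E x₀).symm u)) :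
    Function.Surjective (fderiv ℝ (ρ ∘ (chartAt E x₀).symm) u) ↔
      Function.Surjective (realMFDeriv E (Fin n → ℝ) ρ ((chartAt E x₀).symm u)) := by
  rw [fderiv_comp_chart_symm x₀ hu hρ]
  exact (bijective_realMFDeriv_chart_symm x₀ hu).2.of_comp_iff _

theorem isOpen_regularLocus {U : Set X} (hU : IsOpen U)
    (hρ : ContMDiffOn 𝓘(ℝ, E) 𝓘(ℝ, Fin n → ℝ) 1 ρ U) : IsOpen (regularLocus (E := E) ρ U) := by
  refine isOpen_iff_mem_nhds.2 fun x hx => ?_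
  set e := chartAt E x
  have h_iff : ∀ y ∈ e.source ∩ U, Function.Surjective (fderiv ℝ (ρ ∘ e.symm) (e y)) ↔
      Function.Surjective (realMFDeriv E (Fin n → ℝ) ρ y) := fun y hy => by
    have hρy := (hρ.contMDiffAt (hU.mem_nhds hy.2)).mdifferentiableAt one_ne_zero
    rw [← e.left_inv hy.1] at hρy
    rw [surjective_fderiv_comp_chart_symm_iff x (e.map_source hy.1) hρy, e.left_inv hy.1]
  have hx_source : x ∈ e.source := mem_chart_source E x
  have h_cont : ContinuousAt (fun y => fderiv ℝ (ρ ∘ e.symm) (e y)) x := by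
    refine ContinuousAt.comp (g := fderiv ℝ (ρ ∘ e.symm)) ?_ (e.continuousAt hx_source)
    refine (continuousOn_fderiv_comp_chart_symm hU hρ x).continuousAt
      ((e.isOpen_inter_preimage_symm hU).mem_nhds ⟨e.map_source hx_source, ?_⟩)
    rw [Set.mem_preimage, e.left_inv hx_source]
    exact hx.1
  filter_upwards [e.open_source.mem_nhds hx_source, hU.mem_nhds hx.1, h_cont.preimage_mem_nhds
    (isOpen_surjective.mem_nhds ((h_iff x ⟨hx_source, hx.1⟩).2 hx.2))] with y hy hyU hy_surj
  exact ⟨hyU, (h_iff y ⟨hy, hyU⟩).1 hy_surj⟩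

end RegularLocus

section TorusExp

variable {k : ℕ}

theorem torusExp_zero : torusExp (0 : Fin k → ℝ) = 1 := by
  ext i
  simp [torusExp]

theorem torusExp_add (s t : Fin k → ℝ) : torusExp (s + t) = torusExp s * torusExp t := by
  ext i
  simp [torusExp, Circle.exp_add]

theorem torusExp_single_two_pi (i : Fin k) : torusExp (Pi.single i (2 * Real.pi)) = 1 := by
  funext j
  rcases eq_or_ne j i with rfl | hji
  · simp [torusExp]
  · simp [torusExp, hji]

end TorusExp

namespace IsHamiltonianTorusAction

variable {E : Type*} [NormedAddCommGroup E] [NormedSpace ℂ E]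
  {X : Type*} [TopologicalSpace X] [ChartedSpace E X] {κ : X → E [⋀^Fin 2]→L[ℝ] ℝ}
  {k : ℕ} {act : (Fin k → Circle) → X → X} {μ : X → (Fin k → ℝ) →L[ℝ] ℝ}

theorem isSmoothAction (h : IsHamiltonianTorusAction κ act μ) :
    IsSmoothAction E fun u => act (torusExp u) where
  zero_act x := by rw [torusExp_zero, h.one_act]
  add_act u v x := by rw [torusExp_add, h.mul_act]
  contMDiff := h.smooth_act

theorem fundamentalVectorField_eq (h : IsHamiltonianTorusAction κ act μ) (v : Fin k → ℝ) (x : X) :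
    fundamentalVectorField act v x = orbitDeriv E (fun u => act (torusExp u)) x v := by
  rw [fundamentalVectorField, (h.isSmoothAction.hasMFDerivAt_curve x v).mfderiv]
  exact congrArg (orbitDeriv E _ x) (one_smul ℝ v)

theorem dense_linearIndependent_fundamentalVectorField [FiniteDimensional ℂ E]
    [IsManifold 𝓘(ℝ, E) 1 X] [T2Space X] [PreconnectedSpace X]
    (h : IsHamiltonianTorusAction κ act μ)
    (h_eff : ∀ v : Fin k → ℝ, (∀ x : X, (fundamentalVectorField act v x : E) = 0) → v = 0)
    {ι : Type*} (b : Module.Basis ι ℝ (Fin k → ℝ)) :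
    Dense {x | LinearIndependent ℝ fun i => (fundamentalVectorField act (b i) x : E)} := by
  have := FiniteDimensional.complexToReal E
  have := Manifold.locallyCompact_of_finiteDimensional (M := X) 𝓘(ℝ, E)
  simp only [h.fundamentalVectorField_eq] at h_eff ⊢
  let lattice : Module.Basis (Fin k) ℝ (Fin k → ℝ) :=
    (Pi.basisFun ℝ (Fin k)).isUnitSMul fun _ => Real.two_pi_pos.ne'.isUnit
  refine (h.isSmoothAction.dense_injective_orbitDeriv lattice (fun i x => ?_) h_eff).mono
    fun x hx => b.linearIndependent.map' _ (LinearMap.ker_eq_bot.2 hx)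
  have h_lattice : lattice i = Pi.single i (2 * Real.pi) := by
    simp [lattice, Module.Basis.isUnitSMul_apply, ← Pi.single_smul]
  rw [h_lattice, torusExp_single_two_pi, h.one_act]

theorem realMFDeriv_fundamentalVectorField_eq_zero (h : IsHamiltonianTorusAction κ act μ)
    {W : Type*} [NormedAddCommGroup W] [NormedSpace ℝ W] {φ : X → W} {x : X}
    (hφ : MDifferentiableAt 𝓘(ℝ, E) 𝓘(ℝ, W) φ x) (h_inv : ∀ t, φ (act t x) = φ x)
    (v : Fin k → ℝ) : realMFDeriv E W φ x (fundamentalVectorField act v x) = 0 := by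
  rw [h.fundamentalVectorField_eq]
  exact h.isSmoothAction.realMFDeriv_orbitDeriv_eq_zero hφ (fun u => h_inv (torusExp u)) v

theorem contMDiff_moment_apply (h : IsHamiltonianTorusAction κ act μ) (v : Fin k → ℝ) :
    ContMDiff 𝓘(ℝ, E) 𝓘(ℝ, ℝ) ∞ fun y => μ y v :=
  (ContinuousLinearMap.apply ℝ ℝ v).contMDiff.comp h.smooth_moment

theorem apply_fundamentalVectorField_eq_zero (h : IsHamiltonianTorusAction κ act μ)
    (v w : Fin k → ℝ) (x : X) :
    κ x ![fundamentalVectorField act v x, fundamentalVectorField act w x] = 0 :=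
  (h.moment_eq v x _).trans <| h.realMFDeriv_fundamentalVectorField_eq_zero
    ((h.contMDiff_moment_apply v).mdifferentiable (by simp) x)
    (fun t => by rw [h.moment_invariant]) w

variable [FiniteDimensional ℂ E]

theorem poissonCommuteAt_moment (h : IsHamiltonianTorusAction κ act μ) (hκ : IsKahlerForm κ)
    {g : X → ℝ} {x : X} (hg : MDifferentiableAt 𝓘(ℝ, E) 𝓘(ℝ, ℝ) g x)
    (h_inv : ∀ t, g (act t x) = g x) (v : Fin k → ℝ) :
    PoissonCommuteAt κ g (fun y => μ y v) x :=
  (hκ.poissonCommuteAt_iff (h.moment_eq v x)).2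
    (h.realMFDeriv_fundamentalVectorField_eq_zero hg h_inv v)

theorem poissonCommuteAt_moment_moment (h : IsHamiltonianTorusAction κ act μ)
    (hκ : IsKahlerForm κ) (v w : Fin k → ℝ) (x : X) :
    PoissonCommuteAt κ (fun y => μ y v) (fun y => μ y w) x :=
  h.poissonCommuteAt_moment hκ ((h.contMDiff_moment_apply v).mdifferentiable (by simp) x)
    (fun t => by rw [h.moment_invariant]) w

theorem exists_append_apply_ne_zero (h : IsHamiltonianTorusAction κ act μ)
    (hκ : IsKahlerForm κ) {m : ℕ} (hE : Module.finrank ℂ E = k + m)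
    {v : Fin k → Fin k → ℝ} {x : X}
    (hv : LinearIndependent ℝ fun i => (fundamentalVectorField act (v i) x : E))
    {η : E [⋀^Fin (k + m)]→L[ℂ] ℂ} (hη : η ≠ 0) :
    ∃ w : Fin m → E, η (Fin.append (fun i => fundamentalVectorField act (v i) x) w) ≠ 0 :=
  _root_.exists_append_apply_ne_zero hE (f := η.toAlternatingMap)
    (fun h_zero => hη (ContinuousAlternatingMap.toAlternatingMap_injective h_zero))
    ((hκ.isTaming x).linearIndependent_complex hv
      fun i j => h.apply_fundamentalVectorField_eq_zero (v i) (v j) x)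

end IsHamiltonianTorusAction

section ComplexNorm

theorem hasFDerivAt_complex_norm {z : ℂ} (hz : z ≠ 0) :
    HasFDerivAt (fun w : ℂ => ‖w‖)
      (Complex.reCLM.comp
        ((((‖z‖ : ℂ) * z⁻¹) • ContinuousLinearMap.id ℂ ℂ).restrictScalars ℝ)) z := by
  have h_sqrt := ((hasFDerivAt_id (𝕜 := ℝ) z).norm_sq).sqrt (by simpa using hz)
  simp only [id, Real.sqrt_sq (norm_nonneg _)] at h_sqrt
  have := norm_ne_zero_iff.2 hz
  have h_inv : (‖z‖ : ℂ) * z⁻¹ = (‖z‖⁻¹ : ℝ) * (starRingEnd ℂ) z := by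
    rw [Complex.inv_def, Complex.normSq_eq_norm_sq]
    push_cast
    field_simp
  refine h_sqrt.congr_fderiv (ContinuousLinearMap.ext fun w => ?_)
  change 1 / (2 * ‖z‖) * (2 • inner ℝ z w) = ((‖z‖ : ℂ) * z⁻¹ * w).re
  rw [h_inv, mul_assoc, Complex.re_ofReal_mul, Complex.inner, mul_comm w, two_nsmul]
  ring

variable {E : Type*} [NormedAddCommGroup E] [NormedSpace ℂ E]
  {X : Type*} [TopologicalSpace X] [ChartedSpace E X] {g : X → ℂ}

theorem contMDiffOn_norm {U : Set X} (hg : ContMDiffOn 𝓘(ℂ, E) 𝓘(ℂ, ℂ) ω g U)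
    (hg_ne : ∀ x ∈ U, g x ≠ 0) : ContMDiffOn 𝓘(ℝ, E) 𝓘(ℝ, ℝ) ∞ (fun x => ‖g x‖) U :=
  fun x hx => (contDiffAt_norm ℝ (hg_ne x hx)).contMDiffAt.comp_contMDiffWithinAt x
    (contMDiffOn_real_of_complex hg x hx)

theorem realMFDeriv_norm {x : X} (hg : MDifferentiableAt 𝓘(ℂ, E) 𝓘(ℂ, ℂ) g x)
    (hg_ne : g x ≠ 0) : realMFDeriv E ℝ (fun y => ‖g y‖) x =
      Complex.reCLM.comp (((‖g x‖ : ℂ) • dlog g x).restrictScalars ℝ) := by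
  refine (hasMFDerivAt_comp_of_eq (hasFDerivAt_complex_norm hg_ne).hasMFDerivAt
    (hasMFDerivAt_real_of_complex hg.hasMFDerivAt) rfl).mfderiv.trans
    (ContinuousLinearMap.ext fun v => ?_)
  exact congrArg Complex.re (mul_assoc _ _ _)

theorem dlog_comp {E' : Type*} [NormedAddCommGroup E'] [NormedSpace ℂ E'] {Y : Type*}
    [TopologicalSpace Y] [ChartedSpace E' Y] {F : X → Y} {f : Y → ℂ} {x : X}
    (hf : MDifferentiableAt 𝓘(ℂ, E') 𝓘(ℂ, ℂ) f (F x))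
    (hF : MDifferentiableAt 𝓘(ℂ, E) 𝓘(ℂ, E') F x) :
    dlog (E := E) (f ∘ F) x =
      (dlog (E := E') f (F x)).comp (mfderiv 𝓘(ℂ, E) 𝓘(ℂ, E') F x : E →L[ℂ] E') :=
  ContinuousLinearMap.ext fun v =>
    congrArg ((f (F x))⁻¹ * ·) (DFunLike.congr_fun (mfderiv_comp x hf hF) v)

theorem dlog_fundamentalVectorField_eq_zero {κ : X → E [⋀^Fin 2]→L[ℝ] ℝ} {k : ℕ}
    {act : (Fin k → Circle) → X → X} {μ : X → (Fin k → ℝ) →L[ℝ] ℝ}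
    (h : IsHamiltonianTorusAction κ act μ) {x : X}
    (hg : MDifferentiableAt 𝓘(ℂ, E) 𝓘(ℂ, ℂ) g x) (h_inv : ∀ t, g (act t x) = g x)
    (v : Fin k → ℝ) : dlog (E := E) g x (fundamentalVectorField act v x) = 0 := by
  have h_zero := h.realMFDeriv_fundamentalVectorField_eq_zero (W := ℂ)
    (hasMFDerivAt_real_of_complex hg.hasMFDerivAt).mdifferentiableAt h_inv v
  rw [realMFDeriv_eq_restrictScalars hg] at h_zero
  exact (congrArg ((g x)⁻¹ * ·) h_zero).trans (mul_zero _)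

end ComplexNorm

namespace IsVolumeFormWithSimplePoles

variable {E : Type*} [NormedAddCommGroup E] [NormedSpace ℂ E]
  {X : Type*} [TopologicalSpace X] [ChartedSpace E X] {n : ℕ} {Ω : X → E [⋀^Fin n]→L[ℂ] ℂ}
  {D : Set X}

theorem isOpen_compl (h : IsVolumeFormWithSimplePoles Ω D) : IsOpen Dᶜ := by
  refine isOpen_iff_mem_nhds.2 fun x hx => ?_
  obtain ⟨U, hU, hxU, s, η, hs, hD, -⟩ := h x
  have hsx : s x ≠ 0 := fun h_zero => hx (hD.ge ⟨hxU, h_zero⟩ : x ∈ D ∩ U).1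
  filter_upwards [hU.mem_nhds hxU,
    (hs.continuousOn.continuousAt (hU.mem_nhds hxU)).eventually_ne hsx] with y hy hsy hyD
  exact hsy (hD.le ⟨hyD, hy⟩ : y ∈ {y ∈ U | s y = 0}).2

theorem ne_zero (h : IsVolumeFormWithSimplePoles Ω D) {x : X} (hx : x ∉ D) : Ω x ≠ 0 := by
  obtain ⟨U, -, hxU, s, η, -, -, -, -, hη, hηs⟩ := h x
  intro h_zero
  exact hη x hxU (by rw [hηs x ⟨hxU, hx⟩, h_zero]; exact smul_zero (A := E [⋀^Fin n]→L[ℂ] ℂ) (s x))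

end IsVolumeFormWithSimplePoles

section Parallel

variable {E : Type*} [NormedAddCommGroup E] [NormedSpace ℂ E]
  {X : Type*} [TopologicalSpace X] [ChartedSpace E X] {κ : X → E [⋀^Fin 2]→L[ℝ] ℝ}
  {E' : Type*} [NormedAddCommGroup E'] [NormedSpace ℂ E']
  {Y : Type*} [TopologicalSpace Y] [ChartedSpace E' Y] {κ' : Y → E' [⋀^Fin 2]→L[ℝ] ℝ}
  {F : X → Y} {x : X}

/-- The compatibility of a pseudotoric structure with the symplectic connection, at one point: the
Hamiltonian vector of `F^* h` is proportional to the horizontal lift of that of `h`. -/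
def IsParallelAt (κ : X → E [⋀^Fin 2]→L[ℝ] ℝ) (κ' : Y → E' [⋀^Fin 2]→L[ℝ] ℝ) (F : X → Y) (x : X) :
    Prop :=
  ∀ h : Y → ℝ, ContMDiff 𝓘(ℝ, E') 𝓘(ℝ, ℝ) ∞ h → ∀ (v : E) (u : E') (w : E),
    IsHamiltonianVector κ (h ∘ F) x v → IsHamiltonianVector κ' h (F x) u →
      IsHorizontalLift κ F x u w → ∃ c : ℝ, v = c • w

theorem PseudotoricStructure.isParallelAt {k m : ℕ} {T : ToricKahlerStructure m E' Y}
    (P : PseudotoricStructure k κ T) (hx : x ∉ P.base)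
    (h_surj : Function.Surjective (realMFDeriv E E' P.map x)) :
    IsParallelAt κ T.form P.map x := fun h hh v u w hv hu hw =>
  have ⟨c, hc⟩ := P.parallel h hh
  ⟨c x, hc x hx h_surj v u w hv hu hw⟩

theorem exists_contMDiff_eventuallyEq {V : Type*} [NormedAddCommGroup V] [NormedSpace ℝ V]
    [FiniteDimensional ℝ V] {M : Type*} [TopologicalSpace M] [ChartedSpace V M] [T2Space M]
    [IsManifold 𝓘(ℝ, V) ∞ M] {h : M → ℝ} {U : Set M} (hU : IsOpen U)
    (hh : ContMDiffOn 𝓘(ℝ, V) 𝓘(ℝ, ℝ) ∞ h U) {y : M} (hy : y ∈ U) :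
    ∃ h' : M → ℝ, ContMDiff 𝓘(ℝ, V) 𝓘(ℝ, ℝ) ∞ h' ∧ h' =ᶠ[𝓝 y] h := by
  obtain ⟨χ, -, hχ⟩ := (SmoothBumpFunction.nhds_basis_tsupport (I := 𝓘(ℝ, V)) y).mem_iff.1
    (hU.mem_nhds hy)
  refine ⟨fun z => χ z * h z, contMDiff_of_tsupport fun z hz => ?_, ?_⟩
  · exact χ.contMDiff.contMDiffAt.mul
      (hh.contMDiffAt (hU.mem_nhds (hχ (tsupport_mul_subset_left hz))))
  · filter_upwards [χ.eventuallyEq_one] with z hz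
    rw [hz, Pi.one_apply, one_mul]

variable [FiniteDimensional ℂ E] [FiniteDimensional ℂ E'] [T2Space Y] [IsManifold 𝓘(ℝ, E') ∞ Y]

theorem IsParallelAt.poissonCommuteAt_comp (h_par : IsParallelAt κ κ' F x) (hκ : IsKahlerForm κ)
    (hκ' : IsKahlerForm κ') (hF : MDifferentiableAt 𝓘(ℂ, E) 𝓘(ℂ, E') F x)
    (h_surj : Function.Surjective (realMFDeriv E E' F x)) {g h : Y → ℝ} {U : Set Y}
    (hU : IsOpen U) (hxU : F x ∈ U) (hg : MDifferentiableAt 𝓘(ℝ, E') 𝓘(ℝ, ℝ) g (F x))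
    (hh : ContMDiffOn 𝓘(ℝ, E') 𝓘(ℝ, ℝ) ∞ h U) (hgh : PoissonCommuteAt κ' g h (F x)) :
    PoissonCommuteAt κ (g ∘ F) (h ∘ F) x := by
  have := FiniteDimensional.complexToReal E'
  have hF_eq := realMFDeriv_eq_restrictScalars hF
  have hF_real := (hasMFDerivAt_real_of_complex hF.hasMFDerivAt).mdifferentiableAt
  obtain ⟨v, hv⟩ := hκ.exists_isHamiltonianVector (h ∘ F) x
  obtain ⟨u, hu⟩ := hκ'.exists_isHamiltonianVector h (F x)
  obtain ⟨w, hwu, hw⟩ : ∃ w, IsHorizontalLift κ F x u w := by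
    let A : E →L[ℂ] E' := mfderiv 𝓘(ℂ, E) 𝓘(ℂ, E') F x
    have hA : Function.Surjective A := by
      rw [hF_eq] at h_surj
      exact h_surj
    obtain ⟨w, hwu, hw⟩ :=
      (hκ.isTaming x).exists_orthogonal_ker_lift (A := (A : E →ₗ[ℂ] E')) hA u
    exact ⟨w, (DFunLike.congr_fun hF_eq w).trans hwu,
      fun z hz => hw z ((DFunLike.congr_fun hF_eq z).symm.trans hz)⟩
  obtain ⟨h', hh', h_germ⟩ := exists_contMDiff_eventuallyEq hU hh hxU
  obtain ⟨c, rfl⟩ := h_par h' hh' v u w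
    ((isHamiltonianVector_congr (hF.continuousAt.eventually h_germ)).2 hv)
    ((isHamiltonianVector_congr h_germ).2 hu) ⟨hwu, hw⟩
  have h_lift : realMFDeriv E E' F x w = u := hwu
  rw [hκ.poissonCommuteAt_iff hv, realMFDeriv_comp hg hF_real, ContinuousLinearMap.comp_apply,
    map_smul, h_lift, map_smul, (hκ'.poissonCommuteAt_iff hu).1 hgh, smul_zero]

end Parallel

section Components

variable {E : Type*} [NormedAddCommGroup E] [NormedSpace ℝ E]
  {X : Type*} [TopologicalSpace X] [ChartedSpace E X] {n : ℕ} {ρ : X → Fin n → ℝ} {x : X}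

theorem realMFDeriv_component (hρ : MDifferentiableAt 𝓘(ℝ, E) 𝓘(ℝ, Fin n → ℝ) ρ x) (i : Fin n) :
    realMFDeriv E ℝ (fun y => ρ y i) x =
      (ContinuousLinearMap.proj (R := ℝ) (φ := fun _ : Fin n => ℝ) i).comp
        (realMFDeriv E (Fin n → ℝ) ρ x) :=
  (hasMFDerivAt_comp_of_eq (ContinuousLinearMap.proj (R := ℝ) (φ := fun _ : Fin n => ℝ)
    i).hasFDerivAt.hasMFDerivAt (hasMFDerivAt_realMFDeriv hρ) rfl).mfderiv

theorem surjective_realMFDeriv_iff (hρ : MDifferentiableAt 𝓘(ℝ, E) 𝓘(ℝ, Fin n → ℝ) ρ x) :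
    Function.Surjective (realMFDeriv E (Fin n → ℝ) ρ x) ↔
      LinearIndependent ℝ fun i => realMFDeriv E ℝ (fun y => ρ y i) x := by
  simp only [surjective_iff_linearIndependent_proj_comp, realMFDeriv_component hρ]

theorem realMFDeriv_sub_const (hρ : MDifferentiableAt 𝓘(ℝ, E) 𝓘(ℝ, Fin n → ℝ) ρ x)
    (c : Fin n → ℝ) :
    realMFDeriv E (Fin n → ℝ) (fun y => ρ y - c) x = realMFDeriv E (Fin n → ℝ) ρ x :=
  (hasMFDerivAt_comp_of_eq ((hasFDerivAt_id (𝕜 := ℝ) (ρ x)).sub_const c).hasMFDerivAt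
    (hasMFDerivAt_realMFDeriv hρ) rfl).mfderiv.trans (ContinuousLinearMap.id_comp _)

end Components

section Fibration

variable {E : Type*} [NormedAddCommGroup E] [NormedSpace ℂ E] [FiniteDimensional ℂ E]
  {X : Type*} [TopologicalSpace X] [ChartedSpace E X] {κ : X → E [⋀^Fin 2]→L[ℝ] ℝ}
  {n : ℕ} {ρ : X → Fin n → ℝ} {U : Set X} {Ω : X → E [⋀^Fin n]→L[ℂ] ℂ} {θ : ℝ} {x : X}

theorem IsKahlerForm.exists_linearIndependent_hamiltonian (hκ : IsKahlerForm κ)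
    (hρ : MDifferentiableAt 𝓘(ℝ, E) 𝓘(ℝ, Fin n → ℝ) ρ x)
    (h_surj : Function.Surjective (realMFDeriv E (Fin n → ℝ) ρ x))
    (h_comm : ∀ i j, PoissonCommuteAt κ (fun y => ρ y i) (fun y => ρ y j) x) :
    ∃ ξ : Fin n → E, (∀ i, IsHamiltonianVector κ (fun y => ρ y i) x (ξ i)) ∧
      LinearIndependent ℝ ξ ∧ ∀ i, realMFDeriv E (Fin n → ℝ) ρ x (ξ i) = 0 := by
  choose ξ hξ using fun i => hκ.exists_isHamiltonianVector (fun y => ρ y i) x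
  refine ⟨ξ, hξ, linearIndependent_of_surjective h_surj fun i v => (hξ i v).trans
    (DFunLike.congr_fun (realMFDeriv_component hρ i) v), fun i => funext fun j => ?_⟩
  exact (DFunLike.congr_fun (realMFDeriv_component hρ j) (ξ i)).symm.trans
    ((hκ.poissonCommuteAt_iff (hξ i)).1 (h_comm j i))

theorem IsKahlerForm.apply_eq_zero_of_realMFDeriv_eq_zero (hκ : IsKahlerForm κ)
    (hE : Module.finrank ℂ E = n) (hρ : MDifferentiableAt 𝓘(ℝ, E) 𝓘(ℝ, Fin n → ℝ) ρ x)
    (h_surj : Function.Surjective (realMFDeriv E (Fin n → ℝ) ρ x))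
    (h_comm : ∀ i j, PoissonCommuteAt κ (fun y => ρ y i) (fun y => ρ y j) x) {v w : E}
    (hv : realMFDeriv E (Fin n → ℝ) ρ x v = 0) (hw : realMFDeriv E (Fin n → ℝ) ρ x w = 0) :
    κ x ![v, w] = 0 := by
  obtain ⟨ξ, hξ, -, hξ_ker⟩ := hκ.exists_linearIndependent_hamiltonian hρ h_surj h_comm
  exact apply_eq_zero_of_ker hE h_surj
    (fun i v => (hξ i v).trans (DFunLike.congr_fun (realMFDeriv_component hρ i) v)) hξ_ker hv hw

variable [IsManifold 𝓘(ℝ, E) 1 X]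

theorem isSpecialLagrangian_fibre (hκ : IsKahlerForm κ) (hE : Module.finrank ℂ E = n)
    (hU : IsOpen U) (hρ : ContMDiffOn 𝓘(ℝ, E) 𝓘(ℝ, Fin n → ℝ) ∞ ρ U)
    (h_comm : ∀ i j, ∀ x ∈ U, PoissonCommuteAt κ (fun y => ρ y i) (fun y => ρ y j) x)
    (h_phase : ∀ x ∈ regularLocus (E := E) ρ U, ∃ e : Fin n → E, LinearIndependent ℝ e ∧
      (∀ i, realMFDeriv E (Fin n → ℝ) ρ x (e i) = 0) ∧
        (Complex.exp (θ * Complex.I) * Ω x e).im = 0) (c : Fin n → ℝ) :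
    IsSpecialLagrangian κ Ω θ {x ∈ regularLocus (E := E) ρ U | ρ x = c} := by
  have hρ_diff : ∀ y ∈ U, MDifferentiableAt 𝓘(ℝ, E) 𝓘(ℝ, Fin n → ℝ) ρ y := fun y hy =>
    (hρ.contMDiffAt (hU.mem_nhds hy)).mdifferentiableAt (by simp)
  have h_sub : ∀ y ∈ U, realMFDeriv E (Fin n → ℝ) (fun z => ρ z - c) y =
      realMFDeriv E (Fin n → ℝ) ρ y := fun y hy => realMFDeriv_sub_const (hρ_diff y hy) c
  refine fun x hx => ⟨regularLocus (E := E) ρ U, isOpen_regularLocus hU (hρ.of_le (by simp)), hx.1,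
    fun y => ρ y - c, (hρ.mono fun y hy => hy.1).sub contMDiffOn_const, fun y hy => ?_, ?_,
    fun y ⟨_, hyU, hy_surj⟩ => ⟨fun v w hv hw => ?_, fun v hv => ?_⟩⟩
  · exact (congrArg (fun L : E →L[ℝ] Fin n → ℝ => Function.Surjective L) (h_sub y hy.1)).mpr hy.2
  · ext y
    exact ⟨fun hy => ⟨hy.2, sub_eq_zero.2 hy.1.2⟩, fun hy => ⟨⟨hy.1, sub_eq_zero.1 hy.2⟩, hy.1⟩⟩
  · exact hκ.apply_eq_zero_of_realMFDeriv_eq_zero hE (hρ_diff y hyU) hy_surj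
      (fun i j => h_comm i j y hyU) ((DFunLike.congr_fun (h_sub y hyU) v).symm.trans hv)
      ((DFunLike.congr_fun (h_sub y hyU) w).symm.trans hw)
  · obtain ⟨e, he, he_ker, h_im⟩ := h_phase y ⟨hyU, hy_surj⟩
    exact im_mul_eq_zero_of_ker hE hy_surj he he_ker h_im
      fun i => (DFunLike.congr_fun (h_sub y hyU) (v i)).symm.trans (hv i)

end Fibration

section MomentNormMap

variable {E : Type*} [NormedAddCommGroup E] [NormedSpace ℂ E]
  {X : Type*} {k m : ℕ} {μ : X → (Fin k → ℝ) →L[ℝ] ℝ} {b : Fin k → Fin k → ℝ} {g : Fin m → X → ℂ}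

/-- The candidate special Lagrangian fibration: the components of the moment map along the elements
`b i` of `Lie(Tᵏ)`, followed by the absolute values of the functions `g j`. -/
noncomputable def momentNormMap (μ : X → (Fin k → ℝ) →L[ℝ] ℝ) (b : Fin k → Fin k → ℝ)
    (g : Fin m → X → ℂ) : X → Fin (k + m) → ℝ :=
  fun x => Fin.append (fun i => μ x (b i)) fun j => ‖g j x‖

theorem momentNormMap_castAdd (i : Fin k) :
    (fun x => momentNormMap μ b g x (Fin.castAdd m i)) = fun x => μ x (b i) :=
  funext fun _ => Fin.append_left _ _ i

theorem momentNormMap_natAdd (j : Fin m) :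
    (fun x => momentNormMap μ b g x (Fin.natAdd k j)) = fun x => ‖g j x‖ :=
  funext fun _ => Fin.append_right _ _ j

variable [TopologicalSpace X] [ChartedSpace E X] {κ : X → E [⋀^Fin 2]→L[ℝ] ℝ}
  {act : (Fin k → Circle) → X → X} {U : Set X} {x : X}

theorem contMDiffOn_momentNormMap (h : IsHamiltonianTorusAction κ act μ)
    (hg : ∀ j, ContMDiffOn 𝓘(ℂ, E) 𝓘(ℂ, ℂ) ω (g j) U) (hg_ne : ∀ j, ∀ x ∈ U, g j x ≠ 0) :
    ContMDiffOn 𝓘(ℝ, E) 𝓘(ℝ, Fin (k + m) → ℝ) ∞ (momentNormMap μ b g) U := by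
  refine contMDiffOn_pi_space.2 (Fin.addCases (fun i => ?_) fun j => ?_)
  · rw [momentNormMap_castAdd]
    exact (h.contMDiff_moment_apply (b i)).contMDiffOn
  · rw [momentNormMap_natAdd]
    exact contMDiffOn_norm (hg j) (hg_ne j)

theorem realMFDeriv_momentNormMap_natAdd
    (hρ : MDifferentiableAt 𝓘(ℝ, E) 𝓘(ℝ, Fin (k + m) → ℝ) (momentNormMap μ b g) x) {j : Fin m}
    (hg : MDifferentiableAt 𝓘(ℂ, E) 𝓘(ℂ, ℂ) (g j) x) (hg_ne : g j x ≠ 0) (v : E) :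
    realMFDeriv E (Fin (k + m) → ℝ) (momentNormMap μ b g) x v (Fin.natAdd k j) =
      ‖g j x‖ * (dlog (g j) x v).re := by
  have h_comp := (realMFDeriv_component hρ (Fin.natAdd k j)).symm
  rw [momentNormMap_natAdd, realMFDeriv_norm hg hg_ne] at h_comp
  exact (DFunLike.congr_fun h_comp v).trans (Complex.re_ofReal_mul _ _)

theorem surjective_realMFDeriv_momentNormMap (h : IsHamiltonianTorusAction κ act μ)
    (hκ : IsKahlerForm κ)
    (hρ : MDifferentiableAt 𝓘(ℝ, E) 𝓘(ℝ, Fin (k + m) → ℝ) (momentNormMap μ b g) x)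
    (hg : ∀ j, MDifferentiableAt 𝓘(ℂ, E) 𝓘(ℂ, ℂ) (g j) x) (hg_ne : ∀ j, g j x ≠ 0)
    (hg_inv : ∀ j t, g j (act t x) = g j x)
    (hb : LinearIndependent ℝ fun i => (fundamentalVectorField act (b i) x : E))
    (h_dlog : LinearIndependent ℂ fun j => (dlog (g j) x : E →L[ℂ] ℂ)) :
    Function.Surjective (realMFDeriv E (Fin (k + m) → ℝ) (momentNormMap μ b g) x) := by
  have h_components : (fun i => realMFDeriv E ℝ (fun y => momentNormMap μ b g y i) x) =
      Fin.append (fun i => contraction (κ x) (fundamentalVectorField act (b i) x))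
        fun j => Complex.reCLM.comp (((‖g j x‖ : ℂ) • dlog (g j) x).restrictScalars ℝ) := by
    refine funext (Fin.addCases (fun i => ?_) fun j => ?_)
    · rw [momentNormMap_castAdd, Fin.append_left]
      exact (isHamiltonianVector_iff.1 (h.moment_eq (b i) x)).symm
    · rw [momentNormMap_natAdd, Fin.append_right, realMFDeriv_norm (hg j) (hg_ne j)]
  have h_scaled : LinearIndependent ℂ fun j => (‖g j x‖ : ℂ) • (dlog (g j) x : E →L[ℂ] ℂ) :=
    h_dlog.units_smul fun j => Units.mk0 (‖g j x‖ : ℂ) (by simpa using hg_ne j)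
  rw [surjective_realMFDeriv_iff hρ, h_components, linearIndependent_append]
  refine (hκ.isTaming x).linearIndependent_contraction_sumElim_re hb h_scaled fun j i => ?_
  exact (congrArg ((‖g j x‖ : ℂ) * ·) (dlog_fundamentalVectorField_eq_zero h (hg j) (hg_inv j)
    (b i))).trans (mul_zero _)

variable [FiniteDimensional ℂ E]

theorem poissonCommuteAt_momentNormMap (h : IsHamiltonianTorusAction κ act μ)
    (hκ : IsKahlerForm κ) (hg : ∀ j, MDifferentiableAt 𝓘(ℝ, E) 𝓘(ℝ, ℝ) (fun y => ‖g j y‖) x)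
    (hg_inv : ∀ j t, g j (act t x) = g j x)
    (h_comm : ∀ i j, PoissonCommuteAt κ (fun y => ‖g i y‖) (fun y => ‖g j y‖) x)
    (i j : Fin (k + m)) :
    PoissonCommuteAt κ (fun y => momentNormMap μ b g y i) (fun y => momentNormMap μ b g y j) x := by
  have h_mixed : ∀ i j, PoissonCommuteAt κ (fun y => ‖g j y‖) (fun y => μ y (b i)) x :=
    fun i j => h.poissonCommuteAt_moment hκ (hg j) (fun t => by rw [hg_inv]) (b i)
  induction i using Fin.addCases <;> induction j using Fin.addCases <;>
    simp only [momentNormMap_castAdd, momentNormMap_natAdd]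
  exacts [h.poissonCommuteAt_moment_moment hκ _ _ x, (h_mixed _ _).symm, h_mixed _ _, h_comm _ _]

theorem exists_linearIndependent_im_phase_eq_zero (h : IsHamiltonianTorusAction κ act μ)
    (hκ : IsKahlerForm κ)
    (hρ : MDifferentiableAt 𝓘(ℝ, E) 𝓘(ℝ, Fin (k + m) → ℝ) (momentNormMap μ b g) x)
    (h_surj : Function.Surjective (realMFDeriv E (Fin (k + m) → ℝ) (momentNormMap μ b g) x))
    (h_comm : ∀ i j, PoissonCommuteAt κ (fun y => momentNormMap μ b g y i)
      (fun y => momentNormMap μ b g y j) x)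
    (hg : ∀ j, MDifferentiableAt 𝓘(ℂ, E) 𝓘(ℂ, ℂ) (g j) x) (hg_ne : ∀ j, g j x ≠ 0)
    {η : E [⋀^Fin (k + m)]→L[ℂ] ℂ}
    (hη : ∀ w : Fin m → E,
      η (Fin.append (fun i : Fin k => fundamentalVectorField act (b i.rev) x) w) =
        wedgeApply (fun j => dlog (g j) x) w) :
    ∃ e : Fin (k + m) → E, LinearIndependent ℝ e ∧
      (∀ i, realMFDeriv E (Fin (k + m) → ℝ) (momentNormMap μ b g) x (e i) = 0) ∧
      (Complex.exp ((-(m * (Real.pi / 2)) : ℝ) * Complex.I) * η e).im = 0 := by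
  obtain ⟨ξ, hξ, hξ_indep, hξ_ker⟩ := hκ.exists_linearIndependent_hamiltonian hρ h_surj h_comm
  have hξ_castAdd : ∀ i, ξ (Fin.castAdd m i) = fundamentalVectorField act (b i) x := fun i => by
    have hξi := hξ (Fin.castAdd m i)
    rw [momentNormMap_castAdd, isHamiltonianVector_iff] at hξi
    exact (hκ.isTaming x).contraction_injective
      (hξi.trans (isHamiltonianVector_iff.1 (h.moment_eq (b i) x)).symm)
  refine ⟨_, linearIndependent_append_rev hξ_indep, ?ker, ?phase⟩
  case ker =>
    refine Fin.addCases (fun i => ?_) fun j => ?_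
    · rw [Fin.append_left, hξ_ker]
    · rw [Fin.append_right, hξ_ker]
  case phase =>
    simp only [hξ_castAdd, hη]
    refine im_phase_mul_wedgeApply fun i j => ?_
    have h_zero := realMFDeriv_momentNormMap_natAdd hρ (hg i) (hg_ne i) (ξ (Fin.natAdd k j))
    rw [hξ_ker] at h_zero
    exact (mul_eq_zero.1 h_zero.symm).resolve_left (norm_ne_zero_iff.2 (hg_ne i))

end MomentNormMap

section DlogComp

variable {E : Type*} [NormedAddCommGroup E] [NormedSpace ℂ E]
  {X : Type*} [TopologicalSpace X] [ChartedSpace E X]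
  {E' : Type*} [NormedAddCommGroup E'] [NormedSpace ℂ E'] [FiniteDimensional ℂ E']
  {Y : Type*} [TopologicalSpace Y] [ChartedSpace E' Y]

theorem surjective_realMFDeriv_of_wedgeApply_dlog_comp_ne_zero
    {m : ℕ} (hE' : Module.finrank ℂ E' = m) {F : X → Y} {f : Fin m → Y → ℂ} {x : X}
    (hF : MDifferentiableAt 𝓘(ℂ, E) 𝓘(ℂ, E') F x)
    (hf : ∀ j, MDifferentiableAt 𝓘(ℂ, E') 𝓘(ℂ, ℂ) (f j) (F x)) {w : Fin m → E}
    (hw : wedgeApply (fun j => dlog (f j ∘ F) x) w ≠ 0) :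
    Function.Surjective (realMFDeriv E E' F x) := by
  simp only [dlog_comp (hf _) hF] at hw
  rw [realMFDeriv_eq_restrictScalars hF]
  exact surjective_of_wedgeApply_comp_ne_zero hE' hw

end DlogComp

section Fibration

variable {E : Type*} [NormedAddCommGroup E] [NormedSpace ℂ E] [FiniteDimensional ℂ E]
  {X : Type*} [TopologicalSpace X] [ChartedSpace E X] {κ : X → E [⋀^Fin 2]→L[ℝ] ℝ}
  {k m : ℕ} {act : (Fin k → Circle) → X → X} {μ : X → (Fin k → ℝ) →L[ℝ] ℝ} {U : Set X}

theorem exists_wedgeApply_dlog_ne_zero (h : IsHamiltonianTorusAction κ act μ)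
    (hκ : IsKahlerForm κ) (hE : Module.finrank ℂ E = k + m) {b : Fin k → Fin k → ℝ}
    {g : Fin m → X → ℂ} {x : X}
    (hb : LinearIndependent ℝ fun i => (fundamentalVectorField act (b i) x : E))
    {η : E [⋀^Fin (k + m)]→L[ℂ] ℂ} (hη : η ≠ 0)
    (hηg : ∀ w : Fin m → E,
      η (Fin.append (fun i : Fin k => fundamentalVectorField act (b i.rev) x) w) =
        wedgeApply (fun j => dlog (g j) x) w) :
    ∃ w : Fin m → E, wedgeApply (fun j => dlog (g j) x) w ≠ 0 :=
  have ⟨w, hw⟩ := h.exists_append_apply_ne_zero hκ hE (hb.comp Fin.rev Fin.rev_injective) hη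
  ⟨w, hηg w ▸ hw⟩

theorem isSpecialLagrangianFibrationOn_momentNormMap [T2Space X] [PreconnectedSpace X]
    [IsManifold 𝓘(ℝ, E) 1 X] (h : IsHamiltonianTorusAction κ act μ)
    (h_eff : ∀ v : Fin k → ℝ, (∀ x : X, (fundamentalVectorField act v x : E) = 0) → v = 0)
    (hκ : IsKahlerForm κ) (hE : Module.finrank ℂ E = k + m)
    (b : Module.Basis (Fin k) ℝ (Fin k → ℝ)) {g : Fin m → X → ℂ} (hU : IsOpen U)
    (hg : ∀ j, ContMDiffOn 𝓘(ℂ, E) 𝓘(ℂ, ℂ) ω (g j) U) (hg_ne : ∀ j, ∀ x ∈ U, g j x ≠ 0)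
    (hg_inv : ∀ j t, ∀ x ∈ U, g j (act t x) = g j x)
    (hg_comm : ∀ i j, ∀ x ∈ U, PoissonCommuteAt κ (fun y => ‖g i y‖) (fun y => ‖g j y‖) x)
    {Ω : X → E [⋀^Fin (k + m)]→L[ℂ] ℂ} (hΩ : ∀ x ∈ U, Ω x ≠ 0)
    (hΩg : ∀ x ∈ U, ∀ w : Fin m → E,
      Ω x (Fin.append (fun i : Fin k => fundamentalVectorField act (b i.rev) x) w) =
        wedgeApply (fun j => dlog (g j) x) w) :
    IsSpecialLagrangianFibrationOn κ Ω (momentNormMap μ b g) U := by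
  have hg_diff : ∀ x ∈ U, ∀ j, MDifferentiableAt 𝓘(ℂ, E) 𝓘(ℂ, ℂ) (g j) x := fun x hx j =>
    ((hg j).contMDiffAt (hU.mem_nhds hx)).mdifferentiableAt (by simp)
  have h_norm_diff : ∀ x ∈ U, ∀ j, MDifferentiableAt 𝓘(ℝ, E) 𝓘(ℝ, ℝ) (fun y => ‖g j y‖) x :=
    fun x hx j => ((contMDiffOn_norm (hg j) (hg_ne j)).contMDiffAt
      (hU.mem_nhds hx)).mdifferentiableAt (by simp)
  have hρ := contMDiffOn_momentNormMap (b := b) h hg hg_ne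
  have hρ_diff : ∀ x ∈ U, MDifferentiableAt 𝓘(ℝ, E) 𝓘(ℝ, Fin (k + m) → ℝ) (momentNormMap μ b g) x :=
    fun x hx => (hρ.contMDiffAt (hU.mem_nhds hx)).mdifferentiableAt (by simp)
  have h_poisson : ∀ i j, ∀ x ∈ U, PoissonCommuteAt κ (fun y => momentNormMap μ b g y i)
      (fun y => momentNormMap μ b g y j) x := fun i j x hx =>
    poissonCommuteAt_momentNormMap h hκ (h_norm_diff x hx) (fun j t => hg_inv j t x hx)
      (fun i j => hg_comm i j x hx) i j
  refine ⟨hU, hρ, h_poisson, isOpen_regularLocus hU (hρ.of_le (by simp)),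
    ((h.dense_linearIndependent_fundamentalVectorField h_eff b).open_subset_closure_inter hU).trans
      (closure_mono ?_), -(m * (Real.pi / 2)),
    isSpecialLagrangian_fibre hκ hE hU hρ h_poisson fun x ⟨hx, h_surj⟩ =>
      exists_linearIndependent_im_phase_eq_zero h hκ (hρ_diff x hx) h_surj
        (fun i j => h_poisson i j x hx) (hg_diff x hx) (fun j => hg_ne j x hx) (hΩg x hx)⟩
  rintro x ⟨hx, hb : LinearIndependent ℝ fun i => (fundamentalVectorField act (b i) x : E)⟩
  obtain ⟨w, hw⟩ := exists_wedgeApply_dlog_ne_zero h hκ hE hb (hΩ x hx) (hΩg x hx)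
  exact ⟨hx, surjective_realMFDeriv_momentNormMap (E := E) h hκ (hρ_diff x hx) (hg_diff x hx)
    (fun j => hg_ne j x hx) (fun j t => hg_inv j t x hx) hb
    (linearIndependent_of_wedgeApply_ne_zero (E := E) hw)⟩

variable {E' : Type*} [NormedAddCommGroup E'] [NormedSpace ℂ E'] [FiniteDimensional ℂ E']
  {Y : Type*} [TopologicalSpace Y] [ChartedSpace E' Y] {κ' : Y → E' [⋀^Fin 2]→L[ℝ] ℝ}
  [T2Space Y] [IsManifold 𝓘(ℝ, E') ∞ Y] {F : X → Y} {f : Fin m → Y → ℂ} {W : Set Y}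

theorem IsParallelAt.poissonCommuteAt_norm_comp {x : X} (h_par : IsParallelAt κ κ' F x)
    (hκ : IsKahlerForm κ) (hκ' : IsKahlerForm κ') (hF : MDifferentiableAt 𝓘(ℂ, E) 𝓘(ℂ, E') F x)
    (h_surj : Function.Surjective (realMFDeriv E E' F x)) (hW : IsOpen W) (hx : F x ∈ W)
    {f₁ f₂ : Y → ℂ} (hf₁ : ContMDiffOn 𝓘(ℂ, E') 𝓘(ℂ, ℂ) ω f₁ W)
    (hf₂ : ContMDiffOn 𝓘(ℂ, E') 𝓘(ℂ, ℂ) ω f₂ W) (hx₁ : f₁ (F x) ≠ 0) (hx₂ : f₂ (F x) ≠ 0)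
    (h_comm : PoissonCommuteAt κ' (fun z => ‖f₁ z‖) (fun z => ‖f₂ z‖) (F x)) :
    PoissonCommuteAt κ (fun y => ‖f₁ (F y)‖) (fun y => ‖f₂ (F y)‖) x := by
  have h_open : ∀ {φ : Y → ℂ}, ContMDiffOn 𝓘(ℂ, E') 𝓘(ℂ, ℂ) ω φ W → IsOpen (W ∩ φ ⁻¹' {0}ᶜ) :=
    fun hφ => hφ.continuousOn.isOpen_inter_preimage hW isOpen_compl_singleton
  have h_norm : ∀ {φ : Y → ℂ}, ContMDiffOn 𝓘(ℂ, E') 𝓘(ℂ, ℂ) ω φ W →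
      ContMDiffOn 𝓘(ℝ, E') 𝓘(ℝ, ℝ) ∞ (fun z => ‖φ z‖) (W ∩ φ ⁻¹' {0}ᶜ) :=
    fun hφ => contMDiffOn_norm (hφ.mono Set.inter_subset_left) fun _ hz => hz.2
  exact h_par.poissonCommuteAt_comp hκ hκ' hF h_surj (h_open hf₂) ⟨hx, hx₂⟩
    (((h_norm hf₁).contMDiffAt ((h_open hf₁).mem_nhds ⟨hx, hx₁⟩)).mdifferentiableAt (by simp))
    (h_norm hf₂) h_comm

theorem proposition3p1_general [T2Space X] [PreconnectedSpace X] [IsManifold 𝓘(ℝ, E) 1 X]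
    (h : IsHamiltonianTorusAction κ act μ)
    (h_eff : ∀ v : Fin k → ℝ, (∀ x : X, (fundamentalVectorField act v x : E) = 0) → v = 0)
    (hκ : IsKahlerForm κ) (hκ' : IsKahlerForm κ')
    (hE : Module.finrank ℂ E = k + m) (hE' : Module.finrank ℂ E' = m)
    (hU : IsOpen U) (hW : IsOpen W) (hFUW : Set.MapsTo F U W)
    (hF : ContMDiffOn 𝓘(ℂ, E) 𝓘(ℂ, E') ω F U) (hF_inv : ∀ t, ∀ x ∈ U, F (act t x) = F x)
    (h_par : ∀ x ∈ U, Function.Surjective (realMFDeriv E E' F x) → IsParallelAt κ κ' F x)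
    (b : Module.Basis (Fin k) ℝ (Fin k → ℝ))
    (hf : ∀ j, ContMDiffOn 𝓘(ℂ, E') 𝓘(ℂ, ℂ) ω (f j) W) (hf_ne : ∀ j, ∀ x ∈ U, f j (F x) ≠ 0)
    (hf_comm : ∀ i j, ∀ y ∈ W, f i y ≠ 0 → f j y ≠ 0 →
      PoissonCommuteAt κ' (fun z => ‖f i z‖) (fun z => ‖f j z‖) y)
    {Ω : X → E [⋀^Fin (k + m)]→L[ℂ] ℂ} (hΩ : ∀ x ∈ U, Ω x ≠ 0)
    (hΩf : ∀ x ∈ U, ∀ w : Fin m → E,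
      Ω x (Fin.append (fun i : Fin k => fundamentalVectorField act (b i.rev) x) w) =
        wedgeApply (fun j => dlog (f j ∘ F) x) w) :
    IsSpecialLagrangianFibrationOn κ Ω (momentNormMap μ b fun j => f j ∘ F) U := by
  have hg : ∀ j, ContMDiffOn 𝓘(ℂ, E) 𝓘(ℂ, ℂ) ω (f j ∘ F) U := fun j => (hf j).comp hF hFUW
  have h_norm : ∀ j, ContMDiffOn 𝓘(ℝ, E) 𝓘(ℝ, ℝ) 1 (fun x => ‖f j (F x)‖) U := fun j =>
    (contMDiffOn_norm (hg j) (hf_ne j)).of_le (by simp)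
  refine isSpecialLagrangianFibrationOn_momentNormMap h h_eff hκ hE b hU hg hf_ne
    (fun j t x hx => congrArg (f j) (hF_inv t x hx)) (fun i j x hx => ?_) hΩ hΩf
  refine hκ.poissonCommuteAt_of_mem_closure hU (h_norm i) (h_norm j) Set.inter_subset_left ?_ hx
    ((h.dense_linearIndependent_fundamentalVectorField h_eff b).open_subset_closure_inter hU hx)
  rintro y ⟨hy, hb : LinearIndependent ℝ fun i => (fundamentalVectorField act (b i) y : E)⟩
  have hFy : MDifferentiableAt 𝓘(ℂ, E) 𝓘(ℂ, E') F y :=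
    (hF.contMDiffAt (hU.mem_nhds hy)).mdifferentiableAt (by simp)
  have hfy : ∀ j, MDifferentiableAt 𝓘(ℂ, E') 𝓘(ℂ, ℂ) (f j) (F y) := fun j =>
    ((hf j).contMDiffAt (hW.mem_nhds (hFUW hy))).mdifferentiableAt (by simp)
  obtain ⟨w, hw⟩ := exists_wedgeApply_dlog_ne_zero h hκ hE hb (hΩ y hy) (hΩf y hy)
  have h_surj := surjective_realMFDeriv_of_wedgeApply_dlog_comp_ne_zero hE' hFy hfy hw
  exact (h_par y hy h_surj).poissonCommuteAt_norm_comp hκ hκ' hFy h_surj hW (hFUW hy) (hf i) (hf j)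
    (hf_ne i y hy) (hf_ne j y hy) (hf_comm i j _ (hFUW hy) (hf_ne i y hy) (hf_ne j y hy))

end Fibration

theorem proposition3p1
    {k m : ℕ} (hk : 1 ≤ k)
    {E : Type*} [NormedAddCommGroup E] [NormedSpace ℂ E] [FiniteDimensional ℂ E]
    (hE : Module.finrank ℂ E = k + m)
    {X : Type*} [TopologicalSpace X] [T2Space X] [SecondCountableTopology X] [ConnectedSpace X]
    [ChartedSpace E X] [IsManifold 𝓘(ℂ, E) ω X]
    {E' : Type*} [NormedAddCommGroup E'] [NormedSpace ℂ E'] [FiniteDimensional ℂ E']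
    (hE' : Module.finrank ℂ E' = m)
    {Y : Type*} [TopologicalSpace Y] [T2Space Y] [SecondCountableTopology Y]
    [ChartedSpace E' Y] [IsManifold 𝓘(ℂ, E') ω Y]
    -- the Kähler manifold `X`, the toric Kähler manifold `Y`, and the pseudotoric structure
    (ωX : X → E [⋀^Fin 2]→L[ℝ] ℝ) (hωX : IsKahlerForm ωX)
    (T : ToricKahlerStructure m E' Y)
    (P : PseudotoricStructure k ωX T)
    -- the meromorphic volume form and its polar divisor
    (D : Set X) (ΩX : X → E [⋀^Fin (k + m)]→L[ℂ] ℂ)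
    (hΩ : IsVolumeFormWithSimplePoles ΩX D)
    -- (i)
    (hD : ∀ t, ∀ x ∈ D, P.act t x ∈ D)
    -- (ii)
    (hBD : P.base ⊆ D)
    (hF : ∀ x ∉ D, P.map x ∉ T.toricDivisor)
    -- a basis of `Lie(Tᵏ)` and the functions `f₁, …, f_m`
    (b : Module.Basis (Fin k) ℝ (Fin k → ℝ))
    (f : Fin m → Y → ℂ)
    (hf_mero : ∀ j, IsMeromorphicFunction (E' := E') (f j))
    (hf_hol : ∀ j, ContMDiffOn 𝓘(ℂ, E') 𝓘(ℂ, ℂ) ω (f j) T.openOrbit)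
    (hf_ne : ∀ j, ∀ x ∉ D, f j (P.map x) ≠ 0)
    -- (iii): `ι_{V₁} ⋯ ι_{V_k} Ω = d log F^*f₁ ∧ ⋯ ∧ d log F^*f_m`; the left-hand side evaluated on
    -- `w` is `Ω(V_k, …, V₁, w₁, …, w_m)`
    (hΩf : ∀ x ∉ D, ∀ w : Fin m → E,
      ΩX x (Fin.append (fun i : Fin k => fundamentalVectorField P.act (b i.rev) x) w) =
        wedgeApply (fun j => dlog (f j ∘ P.map) x) w)
    -- (iv)
    (hf_comm : ∀ i j, ∀ y ∈ T.openOrbit, f i y ≠ 0 → f j y ≠ 0 →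
      PoissonCommuteAt T.form (fun z => ‖f i z‖) (fun z => ‖f j z‖) y) :
    IsSpecialLagrangianFibrationOn ωX ΩX
      (fun x => Fin.append (fun i : Fin k => P.moment x (b i))
        (fun j : Fin m => ‖f j (P.map x)‖)) Dᶜ := by
  have := isManifold_real_of_complex E X
  have := isManifold_real_of_complex E' Y
  exact proposition3p1_general P.hamiltonian P.locally_effective hωX T.kahler hE hE'
    hΩ.isOpen_compl T.isOpen_orbit (fun x hx => Set.notMem_compl_iff.1 (hF x hx))
    (P.meromorphic.holomorphic.mono (Set.compl_subset_compl.2 hBD))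
    (fun t x hx => P.map_invariant t x fun hx' => hx (hBD hx'))
    (fun x hx => P.isParallelAt fun hx' => hx (hBD hx')) b hf_hol hf_ne hf_comm
    (fun x hx => hΩ.ne_zero hx) hΩf
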